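/- **Setting.** For $A=(a,b;c,d)\in SL_2(\mathbb R)$ with $b\ne0$ let $K_A(u,t)=\frac1{\sqrt{i2\pi b}}e^{i\left(\frac{d}{2b}u^2-\frac1b ut+\frac a{2b}t^2\right)}$ and let $F_A(u)=\int_{\mathbb R}f(t)K_A(u,t)\,dt$ be the linear canonical transform of $f$. Let $A_i=(a_i,b_i;c_i,d_i)$, $B_i=(\bar a_i,\bar b_i;\bar c_i,\bar d_i)\in SL_2(\mathbb R)$, $i=1,2$, with $b_i\neq0$, $\bar b_i\ne0$ and $\frac1{b_1}+\frac1{b_2}\neq0$. The generalized linear canonical Wigner distribution (GLWD) of $f\in L^2(\mathbb R)$ is $$W_f(t,u)=\int_{\mathbb R}F_{B_1}\!\left(t+\tfrac\tau2\right)F_{B_2}^*\!\left(t-\tfrac\tau2\right)K_{A_1}\!\left(u,t+\tfrac\tau2\right)K_{A_2}^*\!\left(u,t-\tfrac\tau2\right)d\tau .$$ For signals and noises that are not square-integrable, $W(t,\cdot)$ is, for each $t$, the distribution in $u$ obtained as the weak limit, as $\varepsilon\downarrow0$, of the GLWDs of the signals multiplied by $e^{-\varepsilon s^2}$. Let $f(t)=e^{i(mt+nt^2)}$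 with real $m,n$ (a deterministic LFM signal), and let $n(t)$ be zero-mean white noise of power spectral density $D>0$, i.e. a generalized random process with $\mathbf E[n(s)]=0$, $\mathbf E[n(s)n^*(s')]=D\,\delta(s-s')$; its expected GLWD $\mathbf E[W_n(t,u)]$ is required to be a function continuous in $u$. Put $$\frac1{h_i}=2n\bar b_i+\bar a_i,\qquad l=\frac{\bar d_1-h_1}{8\bar b_1}-\frac{\bar d_2-h_2}{8\bar b_2}+\frac{a_1b_2-a_2b_1}{8b_1b_2},$$ and assume $h_1+h_2\neq0$ whenever both $\frac1{h_i}$ are non-zero. (If $\frac1{h_i}=0$, then $h_i$ is read as $0$.) The output signal-to-noise ratio $\mathrm{OSNR}$ is the peak of $|W_f|$ over $(t,u)\in\mathbb R^2$, divided by the mean of $|\mathbf E[W_n]|$ over the set of the points $(t,u)$ at which the peak is attained. Here the peak is the maximal strength of an impulse of $W_f$: the strength at $(t,u)$ is $|c|$, where $c\,\delta(\cdot-u)$ is the impulse that the distribution $W_f(t,\cdot)$ has at $u$, and it is $0$ if $W_f(t,\cdot)$ has no impulse at $u$. The mean is the arithmetic mean over a finite set, and the average with respect to length over a line or to area over the plane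 (as a limit over growing discs). The OSNR is said to exist if all these objects exist and the mean is non-zero. **Theorem.** The OSNR of the GLWD for $f+n$ exists and equals $$\mathrm{OSNR}_{\mathrm{GLWD}}=\frac{2\pi}{D}\,\frac{|h_1+h_2|}{\left|\frac1{b_1}+\frac1{b_2}\right|}$$ if and only if $l=0$ and $\frac1{h_i}\neq0$ for $i\in\{1,2\}$. -/

import Mathlib

open MeasureTheory Filter Topology Complex
open scoped ComplexConjugate MatrixGroups Matrix.SpecialLinearGroup

noncomputable section

/-- The kernel `K_A(u,t) = (i2πb)^(-1/2) exp(i(d/(2b) u² - ut/b + a/(2b) t²))` of the linear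
canonical transform, `A = (a, b; c, d)` of determinant one; it is meant for `b ≠ 0`. -/
def lctKernel (A : Matrix.SpecialLinearGroup (Fin 2) ℝ) (u t : ℝ) : ℂ :=
  1 / (I * 2 * Real.pi * (A 0 1 : ℝ)) ^ (1 / 2 : ℂ) *
    cexp (I * ((A 1 1 / (2 * A 0 1) * u ^ 2 - 1 / A 0 1 * u * t
      + A 0 0 / (2 * A 0 1) * t ^ 2 : ℝ) : ℂ))

/-- The linear canonical transform `F_A` of a signal `f`. -/
def lct (A : Matrix.SpecialLinearGroup (Fin 2) ℝ) (f : ℝ → ℂ) (u : ℝ) : ℂ :=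
  if A 0 1 = 0 then
    ((A 1 1 : ℝ) : ℂ) ^ (1 / 2 : ℂ) * cexp (I * ((A 1 0 * A 1 1 / 2 * u ^ 2 : ℝ) : ℂ)) *
      f (A 1 1 * u)
  else ∫ t, f t * lctKernel A u t

/-- The generalized linear canonical Wigner distribution of a square-integrable signal:
`W_f(t,u) = ∫ F_{B₁}(t+τ/2) F_{B₂}^*(t-τ/2) K_{A₁}(u,t+τ/2) K_{A₂}^*(u,t-τ/2) dτ`. -/
def glwd (B₁ B₂ A₁ A₂ : Matrix.SpecialLinearGroup (Fin 2) ℝ) (f : ℝ → ℂ) (t u : ℝ) : ℂ :=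
  ∫ τ : ℝ, lct B₁ f (t + τ / 2) * conj (lct B₂ f (t - τ / 2)) *
    (lctKernel A₁ u (t + τ / 2) * conj (lctKernel A₂ u (t - τ / 2)))

/-- The linear frequency modulated signal `s(t) = exp(i(mt + nt²))`. -/
def lfm (m n t : ℝ) : ℂ := cexp (I * ((m * t + n * t ^ 2 : ℝ) : ℂ))

/-- The Gaussian window `exp(-εs²)`. -/
def gaussWindow (ε s : ℝ) : ℂ := cexp (((-ε * s ^ 2 : ℝ)) : ℂ)

/-- Test functions: smooth functions of compact support. -/
def IsTestFunction (φ : ℝ → ℂ) : Prop :=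
  ContDiff ℝ (⊤ : ℕ∞) φ ∧ HasCompactSupport φ

/-- The GLWD of a bounded signal `f` that need not be square-integrable, at time `t`, as a
distribution `W` in the variable `u` (a functional on test functions): the weak limit, as `ε ↓ 0`,
of the GLWDs of the square-integrable signals `exp(-εs²) f(s)`. -/
def HasGLWD (B₁ B₂ A₁ A₂ : Matrix.SpecialLinearGroup (Fin 2) ℝ) (f : ℝ → ℂ) (t : ℝ)
    (W : (ℝ → ℂ) → ℂ) : Prop :=
  ∀ φ, IsTestFunction φ →
    Tendsto (fun ε : ℝ => ∫ u, glwd B₁ B₂ A₁ A₂ (fun s => gaussWindow ε s * f s) t u * φ u)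
      (𝓝[>] 0) (𝓝 (W φ))

/-- The distribution `W` has at the point `u` an impulse `c δ(· - u)` of strength `c` (which is `0`
where `W` is given near `u` by a bounded function): on test functions that are concentrated
at `u` by scaling, `W` acts in the limit like `c δ(· - u)`. -/
def HasImpulse (W : (ℝ → ℂ) → ℂ) (u : ℝ) (c : ℂ) : Prop :=
  ∀ φ, IsTestFunction φ →
    Tendsto (fun r : ℝ => W (fun v => φ ((v - u) / r))) (𝓝[>] 0) (𝓝 (c * φ 0))

/-- Zero-mean white noise of power spectral density `D`, as a generalized random process of
second order: `n g` is the random variable `∫ g(s) n(s) ds`, and `E[n(s)] = 0`,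
`E[n(s) n^*(s')] = D δ(s - s')`. -/
structure IsWhiteNoise {Ω : Type*} [MeasurableSpace Ω] (P : Measure Ω) (D : ℝ)
    (n : Lp ℂ 2 (volume : Measure ℝ) →ₗ[ℂ] Lp ℂ 2 P) : Prop where
  mean_zero : ∀ g, ∫ ω, n g ω ∂P = 0
  covariance : ∀ g h, ∫ ω, n g ω * conj (n h ω) ∂P = D * ∫ s, g s * conj (h s)

theorem memLp_gaussWindow_mul_lctKernel (A : Matrix.SpecialLinearGroup (Fin 2) ℝ) {ε : ℝ}
    (hε : 0 < ε) (u : ℝ) :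
    MemLp (fun s => gaussWindow ε s * lctKernel A u s) 2 (volume : Measure ℝ) := by
  have hc : Continuous fun s => gaussWindow ε s * lctKernel A u s := by
    unfold gaussWindow lctKernel
    fun_prop
  rw [memLp_two_iff_integrable_sq_norm hc.aestronglyMeasurable]
  have h := (integrable_exp_neg_mul_sq (b := 2 * ε) (by positivity)).const_mul
    (‖1 / (I * 2 * Real.pi * (A 0 1 : ℝ)) ^ (1 / 2 : ℂ)‖ ^ 2)
  refine h.congr (Eventually.of_forall fun s => ?_)
  simp only [gaussWindow, lctKernel, norm_mul, Complex.norm_exp_ofReal]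
  rw [Complex.norm_exp_I_mul_ofReal, mul_one, mul_pow, mul_comm]
  congr 1
  rw [← Real.exp_nat_mul]
  congr 1
  push_cast
  ring

/-- The linear canonical transform (`b ≠ 0`) at the point `x` of the noise `exp(-εs²) n(s)`:
the random variable `∫ exp(-εs²) n(s) K_B(x,s) ds`. -/
def noiseLCT {Ω : Type*} [MeasurableSpace Ω] {P : Measure Ω}
    (n : Lp ℂ 2 (volume : Measure ℝ) →ₗ[ℂ] Lp ℂ 2 P)
    (B : Matrix.SpecialLinearGroup (Fin 2) ℝ) (ε x : ℝ) : Lp ℂ 2 P :=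
  if hε : 0 < ε then n ((memLp_gaussWindow_mul_lctKernel B hε x).toLp _) else 0

/-- The GLWD of the noise `exp(-εs²) n(s)` at time `t`, as a random distribution in `u`: the
random variable
`∫ N_{B₁}(t+τ/2) N_{B₂}^*(t-τ/2) (∫ K_{A₁}(u,t+τ/2) K_{A₂}^*(u,t-τ/2) φ(u) du) dτ`. -/
def noiseGLWD {Ω : Type*} [MeasurableSpace Ω] {P : Measure Ω}
    (n : Lp ℂ 2 (volume : Measure ℝ) →ₗ[ℂ] Lp ℂ 2 P)
    (B₁ B₂ A₁ A₂ : Matrix.SpecialLinearGroup (Fin 2) ℝ) (ε t : ℝ) (φ : ℝ → ℂ) : Lp ℂ 1 P :=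
  ∫ τ : ℝ, (∫ u, lctKernel A₁ u (t + τ / 2) * conj (lctKernel A₂ u (t - τ / 2)) * φ u) •
    (noiseLCT n B₁ ε (t + τ / 2) • star (noiseLCT n B₂ ε (t - τ / 2)) : Lp ℂ 1 P)

/-- `E(t,u)` is the expectation `E[W_n(t,u)]` of the GLWD of the noise `n`: at each time `t` a
continuous function of `u` that is the weak limit, as `ε ↓ 0`, of the expectations of the GLWDs
of `exp(-εs²) n(s)`. -/
def HasNoiseMean {Ω : Type*} [MeasurableSpace Ω] {P : Measure Ω}
    (n : Lp ℂ 2 (volume : Measure ℝ) →ₗ[ℂ] Lp ℂ 2 P)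
    (B₁ B₂ A₁ A₂ : Matrix.SpecialLinearGroup (Fin 2) ℝ) (E : ℝ → ℝ → ℂ) : Prop :=
  ∀ t, Continuous (E t) ∧ ∀ φ, IsTestFunction φ →
    Tendsto (fun ε : ℝ => ∫ ω, noiseGLWD n B₁ B₂ A₁ A₂ ε t φ ω ∂P) (𝓝[>] 0)
      (𝓝 (∫ u, E t u * φ u))

/-- `M` is the mean of `g` over a subset `S` of the plane, taken with respect to Hausdorff measure
of the dimension of `S` (the arithmetic mean over a finite set, the average with respect to length
over a line, to area over the plane), as a limit over growing balls if `S` is unbounded. -/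
def HasMeanOver (S : Set (EuclideanSpace ℝ (Fin 2))) (g : EuclideanSpace ℝ (Fin 2) → ℝ)
    (M : ℝ) : Prop :=
  Tendsto (fun r : ℝ => ⨍ z in S ∩ Metric.ball 0 r, g z ∂(μH[(dimH S).toReal])) atTop (𝓝 M)

/-- `v` is the output signal-to-noise ratio of the GLWD for the signal `f` in the noise `n`:
the peak `p` of `|W_f|` (the largest strength of an impulse of `W_f`), divided by the mean `M` of
`|E[W_n]|` over the set of the points `(t,u)` at which the peak is attained. -/
def HasOSNR {Ω : Type*} [MeasurableSpace Ω] {P : Measure Ω}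
    (B₁ B₂ A₁ A₂ : Matrix.SpecialLinearGroup (Fin 2) ℝ) (f : ℝ → ℂ)
    (n : Lp ℂ 2 (volume : Measure ℝ) →ₗ[ℂ] Lp ℂ 2 P) (v : ℝ) : Prop :=
  ∃ (W : ℝ → (ℝ → ℂ) → ℂ) (c E : ℝ → ℝ → ℂ) (p M : ℝ),
    (∀ t, HasGLWD B₁ B₂ A₁ A₂ f t (W t)) ∧
    (∀ t u, HasImpulse (W t) u (c t u)) ∧
    IsGreatest (Set.range fun z : ℝ × ℝ => ‖c z.1 z.2‖) p ∧
    HasNoiseMean n B₁ B₂ A₁ A₂ E ∧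
    HasMeanOver {z | ‖c (z 0) (z 1)‖ = p} (fun z => ‖E (z 0) (z 1)‖) M ∧
    M ≠ 0 ∧ v = p / M

/-- The number `1/h = 2n b + a` belonging to the chirp rate `n` and to `B = (a, b; c, d)`. -/
def chirpInv (n : ℝ) (B : Matrix.SpecialLinearGroup (Fin 2) ℝ) : ℝ := 2 * n * B 0 1 + B 0 0

/-- The number `h` (meaningful if `1/h ≠ 0`). -/
def chirpH (n : ℝ) (B : Matrix.SpecialLinearGroup (Fin 2) ℝ) : ℝ := (chirpInv n B)⁻¹

/-- The number `l = (d̄₁-h₁)/(8b̄₁) - (d̄₂-h₂)/(8b̄₂) + (a₁b₂-a₂b₁)/(8b₁b₂)`. -/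
def chirpL (n : ℝ) (B₁ B₂ A₁ A₂ : Matrix.SpecialLinearGroup (Fin 2) ℝ) : ℝ :=
  (B₁ 1 1 - chirpH n B₁) / (8 * B₁ 0 1) - (B₂ 1 1 - chirpH n B₂) / (8 * B₂ 0 1)
    + (A₁ 0 0 * A₂ 0 1 - A₂ 0 0 * A₁ 0 1) / (8 * A₁ 0 1 * A₂ 0 1)

end

/-!
The transform of a windowed chirp is a Gaussian integral: up to a chirp in `x` it is
`(π/z)^(1/2) exp(-(m - x/b)²/(4z))` with `z = ε - iq`, where `q` is `1/h` divided by `2b`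
(`lct_gaussWindow_mul_lfm`). By Fubini the distribution of the windowed signal, paired with a test
function `φ`, is the integral over the lag `τ` of a product of two such Gaussians against
`kernelPairing`, which is a chirp in `τ` times the Fourier transform of a test function and hence
integrable (`glwd_pairing`). Everything then depends on the behaviour of the Gaussians as `ε → 0`.

If `q₁, q₂ ≠ 0`, they stay bounded and converge to chirps (`hasGLWD_chirpDistribution`). The
coefficient of `τ²` in the total phase is exactly `l`. For `l = 0` Fourier inversion turns the
integral into a point evaluation of `φ`, an impulse of constant strength along a line of the
`(t,u)`-plane (`chirpDistribution_of_chirpL_eq_zero`). For `l ≠ 0` the integral is a bounded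
function of `u`, which has no impulse (`chirpDistribution_hasImpulse_zero`). If exactly one `qᵢ`
vanishes, one transform concentrates in a point and the limit is again a bounded function. In both
cases the peak is `0`, whereas the asserted ratio is not. If both vanish, then the distribution does
not exist at the time at which the two transforms concentrate at the same lag
(`not_hasGLWD_of_both_eq_zero`).

The expected distribution of the noise is treated in the same way: the covariance of the transforms
is a Gaussian of parameter `2ε - ip` with `p = q₁ - q₂`. If `p ≠ 0`, the phase in `τ` has, for
`l = 0`, the curvature `κ` with `κ p = -(h₁ + h₂)² q₁ q₂ / 4` (`noiseCurvature_mul_rateGap`), so the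
expectation is a continuous function of constant modulus; if `p = 0`, the covariance concentrates at
one lag, and the modulus is given by the same formula (`IsWhiteNoise.exists_hasNoiseMean`). Its mean
over the line of the peaks is therefore that constant, and the quotient of the two constants is the
asserted ratio.
-/

noncomputable section

/-! ### The Fourier transform of a complex Gaussian -/

/-- The Fourier integral `∫ exp(-z s² + i w s) ds = (π/z)^(1/2) exp(-w²/(4z))` of the Gaussian of
parameter `z`. The closed form also makes sense for imaginary `z ≠ 0`, where it is the limit from
the right half-plane. -/
def gaussFT (z : ℂ) (w : ℝ) : ℂ :=
  (Real.pi / z) ^ (1 / 2 : ℂ) * cexp (-(w : ℂ) ^ 2 / (4 * z))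

theorem integral_cexp_eq_gaussFT {z : ℂ} (hz : 0 < z.re) (w : ℝ) :
    ∫ s : ℝ, cexp (I * w * s) * cexp (-z * s ^ 2) = gaussFT z w := by
  rw [fourierIntegral_gaussian hz, gaussFT]

theorem norm_cpow_half (z : ℂ) : ‖z ^ (1 / 2 : ℂ)‖ = √‖z‖ := by
  have h : (1 / 2 : ℂ) = ((1 / 2 : ℝ) : ℂ) := by push_cast; rfl
  rw [h, Complex.norm_cpow_real, Real.sqrt_eq_rpow]

theorem re_neg_sq_div (z : ℂ) (w : ℝ) :
    (-(w : ℂ) ^ 2 / (4 * z)).re = -(w ^ 2 * (z.re / (4 * normSq z))) := by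
  have h : -(w : ℂ) ^ 2 / (4 * z) = ((-(w ^ 2) / 4 : ℝ) : ℂ) * z⁻¹ := by
    push_cast; rw [div_mul_eq_div_div]; rfl
  rw [h, Complex.re_ofReal_mul, Complex.inv_re]
  by_cases hz : normSq z = 0
  · simp [hz]
  · field_simp

theorem norm_gaussFT (z : ℂ) (w : ℝ) :
    ‖gaussFT z w‖ = √(Real.pi / ‖z‖) * Real.exp (-(w ^ 2 * (z.re / (4 * normSq z)))) := by
  rw [gaussFT, norm_mul, norm_cpow_half, Complex.norm_exp, re_neg_sq_div, norm_div,
    Complex.norm_real, Real.norm_of_nonneg Real.pi_pos.le]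

theorem norm_gaussFT_le {z : ℂ} (hz : 0 ≤ z.re) (w : ℝ) :
    ‖gaussFT z w‖ ≤ √(Real.pi / ‖z‖) := by
  rw [norm_gaussFT]
  refine mul_le_of_le_one_right (Real.sqrt_nonneg _) (Real.exp_le_one_iff.2 ?_)
  have := normSq_nonneg z
  rw [neg_nonpos]
  positivity

theorem norm_gaussFT_of_re_eq_zero {z : ℂ} (hz : z.re = 0) (w : ℝ) :
    ‖gaussFT z w‖ = √(Real.pi / ‖z‖) := by
  simp [norm_gaussFT, hz]

theorem continuousOn_gaussFT :
    ContinuousOn (fun p : ℂ × ℝ => gaussFT p.1 p.2) {p | 0 ≤ p.1.re ∧ p.1 ≠ 0} := by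
  unfold gaussFT
  have h0 : ∀ p ∈ {p : ℂ × ℝ | 0 ≤ p.1.re ∧ p.1 ≠ 0}, p.1 ≠ 0 := fun p hp => hp.2
  refine ContinuousOn.mul (ContinuousOn.cpow_const ?_ ?_) ?_
  · exact continuousOn_const.div (by fun_prop) h0
  · rintro ⟨z, w⟩ ⟨hz, hz0⟩
    simp only at hz hz0 ⊢
    have hn : 0 < normSq z := normSq_pos.2 hz0
    rw [Complex.mem_slitPlane_iff]
    have hr : ((Real.pi : ℂ) / z).re = Real.pi * z.re / normSq z := by
      simp [div_eq_mul_inv, mul_assoc]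
    have hi : ((Real.pi : ℂ) / z).im = -(Real.pi * z.im / normSq z) := by
      simp [div_eq_mul_inv, mul_assoc]
    rcases hz.lt_or_eq with h | h
    · left; rw [hr]; have := Real.pi_pos; positivity
    · right
      rw [hi, neg_ne_zero]
      have : z.im ≠ 0 := fun h' => hz0 (Complex.ext h.symm h')
      have := Real.pi_ne_zero
      positivity
  · refine Complex.continuous_exp.comp_continuousOn (ContinuousOn.div (by fun_prop) (by fun_prop) ?_)
    intro p hp
    exact mul_ne_zero (by norm_num) (h0 p hp)

/-- Convergence up to the boundary of the right half-plane, away from `0`. -/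
theorem tendsto_gaussFT {ι : Type*} {F : Filter ι} {z : ι → ℂ} {w : ι → ℝ} {z₀ : ℂ} {w₀ : ℝ}
    (hz : Tendsto z F (𝓝 z₀)) (hw : Tendsto w F (𝓝 w₀)) (hz₀ : 0 ≤ z₀.re ∧ z₀ ≠ 0)
    (hre : ∀ᶠ i in F, 0 ≤ (z i).re ∧ z i ≠ 0) :
    Tendsto (fun i => gaussFT (z i) (w i)) F (𝓝 (gaussFT z₀ w₀)) := by
  have h := continuousOn_gaussFT (z₀, w₀) (by exact hz₀)
  rw [ContinuousWithinAt, tendsto_def] at h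
  rw [tendsto_def]
  intro s hs
  have h4 := h s hs
  rw [mem_nhdsWithin_iff_eventually] at h4
  filter_upwards [(hz.prodMk_nhds hw).eventually h4, hre] with i h5 h6
  exact h5 h6

theorem continuous_gaussFT (z : ℂ) : Continuous (gaussFT z) := by
  unfold gaussFT
  fun_prop

theorem integrable_gaussFT {z : ℂ} (hz : 0 < z.re) {α : ℝ} (hα : α ≠ 0) (β : ℝ) :
    Integrable fun τ : ℝ => gaussFT z (α * τ + β) := by
  have hn : 0 < normSq z := normSq_pos.2 fun h => by simp [h] at hz
  have h1 : Integrable fun w : ℝ => gaussFT z w := by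
    refine (((integrable_exp_neg_mul_sq (b := z.re / (4 * normSq z)) (by positivity)).const_mul
      √(Real.pi / ‖z‖)).mono' (continuous_gaussFT z).aestronglyMeasurable ?_)
    refine Eventually.of_forall fun w => ?_
    rw [norm_gaussFT]
    apply le_of_eq
    congr 2
    ring
  exact (h1.comp_add_right β).comp_mul_left' hα

theorem gaussFT_ofReal {ε : ℝ} (hε : 0 < ε) (w : ℝ) :
    gaussFT ε w = ((√Real.pi * ((√ε)⁻¹ * Real.exp (-(w ^ 2) / (4 * ε))) : ℝ) : ℂ) := by
  have h : (1 / 2 : ℂ) = ((1 / 2 : ℝ) : ℂ) := by push_cast; rfl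
  rw [gaussFT, ← Complex.ofReal_div, h, ← Complex.ofReal_cpow (by positivity),
    ← Real.sqrt_eq_rpow, Real.sqrt_div Real.pi_pos.le]
  push_cast
  ring

/-! ### Integrals against concentrating Gaussians -/

/-- The Gaussians `ε^(-1/2) exp(-a(τ-τ₀)²/ε)` concentrate at `τ₀` with total mass `√(π/a)`. The
other factor `r` may depend on `ε`, as long as it converges jointly in `ε` and `τ`. -/
theorem tendsto_integral_concentrating {a : ℝ} (ha : 0 < a) (τ₀ C : ℝ) {r : ℝ → ℝ → ℂ} {r₀ : ℂ}
    (hr : ∀ᶠ ε in 𝓝[>] (0 : ℝ), Continuous (r ε) ∧ ∀ τ, ‖r ε τ‖ ≤ C)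
    (hlim : Tendsto (fun p : ℝ × ℝ => r p.1 p.2) (𝓝[>] 0 ×ˢ 𝓝 τ₀) (𝓝 r₀)) :
    Tendsto (fun ε : ℝ => ∫ τ : ℝ,
      (((√ε)⁻¹ * Real.exp (-a * (τ - τ₀) ^ 2 / ε) : ℝ) : ℂ) * r ε τ)
      (𝓝[>] 0) (𝓝 ((√(Real.pi / a) : ℝ) * r₀)) := by
  have key : ∀ᶠ ε in 𝓝[>] (0 : ℝ), ∫ σ : ℝ, ((Real.exp (-a * σ ^ 2) : ℝ) : ℂ) * r ε (√ε * σ + τ₀)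
      = ∫ τ : ℝ, (((√ε)⁻¹ * Real.exp (-a * (τ - τ₀) ^ 2 / ε) : ℝ) : ℂ) * r ε τ := by
    filter_upwards [self_mem_nhdsWithin] with ε hε
    have hε : 0 < ε := hε
    have hs : 0 < √ε := Real.sqrt_pos.2 hε
    rw [← integral_add_right_eq_self (fun τ : ℝ =>
      (((√ε)⁻¹ * Real.exp (-a * (τ - τ₀) ^ 2 / ε) : ℝ) : ℂ) * r ε τ) τ₀]
    have := Measure.integral_comp_mul_left (fun τ : ℝ =>
      ((Real.exp (-a * τ ^ 2 / ε) : ℝ) : ℂ) * r ε (τ + τ₀)) (√ε)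
    calc _ = ∫ σ : ℝ, ((Real.exp (-a * (√ε * σ) ^ 2 / ε) : ℝ) : ℂ) * r ε (√ε * σ + τ₀) := by
            congr 1; ext σ
            have : -a * (√ε * σ) ^ 2 / ε = -a * σ ^ 2 := by
              rw [mul_pow, Real.sq_sqrt hε.le]; field_simp
            rw [this]
      _ = _ := this
      _ = _ := by
        rw [abs_of_pos (by positivity), ← integral_smul]
        congr 1; ext τ
        simp only [add_sub_cancel_right, real_smul]
        push_cast
        ring
  refine Tendsto.congr' key ?_
  have hI : ∫ σ : ℝ, ((Real.exp (-a * σ ^ 2) : ℝ) : ℂ) * r₀ = (√(Real.pi / a) : ℝ) * r₀ := by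
    rw [integral_mul_const, integral_complex_ofReal, integral_gaussian]
  rw [← hI]
  refine tendsto_integral_filter_of_dominated_convergence (fun σ => Real.exp (-a * σ ^ 2) * C)
    ?_ ?_ ((integrable_exp_neg_mul_sq ha).mul_const C) ?_
  · filter_upwards [hr] with ε hε
    have := hε.1
    exact Continuous.aestronglyMeasurable (by fun_prop)
  · filter_upwards [hr] with ε hε
    refine Eventually.of_forall fun σ => ?_
    rw [norm_mul, Complex.norm_real, Real.norm_of_nonneg (Real.exp_nonneg _)]
    gcongr
    exact hε.2 _
  · refine Eventually.of_forall fun σ => Tendsto.const_mul _ ?_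
    have h1 : Tendsto (fun ε : ℝ => √ε * σ + τ₀) (𝓝[>] 0) (𝓝 τ₀) := by
      have : Continuous fun ε : ℝ => √ε * σ + τ₀ := by fun_prop
      have h := this.tendsto 0
      simp only [Real.sqrt_zero, zero_mul, zero_add] at h
      exact h.mono_left nhdsWithin_le_nhds
    exact hlim.comp (tendsto_id.prodMk h1)

/-! ### Oscillatory integrals of test functions -/

/-- The Fourier transform `s ↦ ∫ ψ(u) exp(-isu) du`, in the normalization without `2π`. -/
def oscInt (ψ : ℝ → ℂ) (s : ℝ) : ℂ := ∫ u, ψ u * cexp (I * ((-(s * u) : ℝ) : ℂ))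

theorem oscInt_eq_fourier (ψ : ℝ → ℂ) (s : ℝ) :
    oscInt ψ s = FourierTransform.fourier ψ (s * (2 * Real.pi)⁻¹) := by
  rw [oscInt, Real.fourier_real_eq_integral_exp_smul]
  congr 1; ext u
  rw [smul_eq_mul, mul_comm]
  congr 2
  have := Real.pi_ne_zero
  have h : -(s * u) = -2 * Real.pi * u * (s * (2 * Real.pi)⁻¹) := by field_simp
  rw [h, mul_comm]

theorem IsTestFunction.exists_schwartz {ψ : ℝ → ℂ} (h : IsTestFunction ψ) :
    ∃ f : SchwartzMap ℝ ℂ, (f : ℝ → ℂ) = ψ :=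
  ⟨h.2.toSchwartzMap h.1, rfl⟩

theorem IsTestFunction.continuous {ψ : ℝ → ℂ} (h : IsTestFunction ψ) : Continuous ψ :=
  h.1.continuous

theorem IsTestFunction.integrable {ψ : ℝ → ℂ} (h : IsTestFunction ψ) : Integrable ψ :=
  h.continuous.integrable_of_hasCompactSupport h.2

theorem IsTestFunction.continuous_fourier {ψ : ℝ → ℂ} (h : IsTestFunction ψ) :
    Continuous (FourierTransform.fourier ψ : ℝ → ℂ) := by
  obtain ⟨f, rfl⟩ := h.exists_schwartz
  rw [← SchwartzMap.fourier_coe]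
  exact (FourierTransform.fourier f).continuous

theorem IsTestFunction.integrable_fourier {ψ : ℝ → ℂ} (h : IsTestFunction ψ) :
    Integrable (FourierTransform.fourier ψ : ℝ → ℂ) := by
  obtain ⟨f, rfl⟩ := h.exists_schwartz
  rw [← SchwartzMap.fourier_coe]
  exact (FourierTransform.fourier f).integrable

theorem continuous_oscInt {ψ : ℝ → ℂ} (h : IsTestFunction ψ) : Continuous (oscInt ψ) := by
  have := h.continuous_fourier
  simp_rw [funext (oscInt_eq_fourier ψ)]
  fun_prop

theorem norm_oscInt_le (ψ : ℝ → ℂ) (s : ℝ) : ‖oscInt ψ s‖ ≤ ∫ u, ‖ψ u‖ := by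
  refine (norm_integral_le_integral_norm _).trans (le_of_eq ?_)
  simp_rw [norm_mul, Complex.norm_exp_I_mul_ofReal, mul_one]

theorem integrable_oscInt {ψ : ℝ → ℂ} (h : IsTestFunction ψ) {b : ℝ} (hb : b ≠ 0) :
    Integrable fun τ => oscInt ψ (b * τ) := by
  simp_rw [oscInt_eq_fourier]
  have h2 : (2 * Real.pi)⁻¹ ≠ 0 := by have := Real.pi_pos; positivity
  exact (h.integrable_fourier.comp_mul_right' h2).comp_mul_left' hb

/-- Fourier inversion: the integral of a pure exponential against the Fourier transform of `ψ` is
a point evaluation of `ψ`. -/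
theorem integral_cexp_mul_oscInt {ψ : ℝ → ℂ} (h : IsTestFunction ψ) {b : ℝ} (hb : b ≠ 0)
    (lam : ℝ) :
    ∫ τ : ℝ, cexp (I * ((lam * τ : ℝ) : ℂ)) * oscInt ψ (b * τ)
      = ((2 * Real.pi / |b| : ℝ) : ℂ) * ψ (lam / b) := by
  have hinv := congrFun (h.continuous.fourierInv_fourier_eq h.integrable h.integrable_fourier)
    (lam / b)
  rw [Real.fourierInv_eq_fourier_neg, Real.fourier_real_eq_integral_exp_smul] at hinv
  have hpi := Real.pi_pos
  have := Measure.integral_comp_mul_left (fun v : ℝ =>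
    cexp (((-2 * Real.pi * v * -(lam / b) : ℝ) : ℂ) * I) • FourierTransform.fourier ψ v)
    (b * (2 * Real.pi)⁻¹)
  rw [hinv] at this
  rw [show ((2 * Real.pi / |b| : ℝ) : ℂ) * ψ (lam / b) = |(b * (2 * Real.pi)⁻¹)⁻¹| • ψ (lam / b) by
    rw [real_smul, mul_inv, inv_inv, abs_mul, abs_inv, abs_of_pos (by positivity : 0 < 2 * Real.pi)]
    push_cast; ring, ← this]
  congr 1; ext τ
  rw [oscInt_eq_fourier, smul_eq_mul]
  congr 2
  · rw [mul_comm]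
    congr 2
    field_simp
  · rw [mul_right_comm]

/-- Fubini for a bounded continuous kernel, an integrable function and a test function. -/
theorem integral_kernel_swap {G φ : ℝ → ℂ} {k : ℝ → ℝ → ℂ} {C : ℝ} (hG : Integrable G)
    (hφ : Integrable φ) (hk : Continuous fun p : ℝ × ℝ => k p.1 p.2)
    (hC : ∀ u τ, ‖k u τ‖ ≤ C) :
    ∫ u, (∫ τ, G τ * k u τ) * φ u = ∫ τ, G τ * ∫ u, k u τ * φ u := by
  have hint : Integrable (fun p : ℝ × ℝ => k p.1 p.2 * (φ p.1 * G p.2)) (volume.prod volume) :=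
    (hφ.mul_prod hG).bdd_mul hk.aestronglyMeasurable (Eventually.of_forall fun p => hC _ _)
  have := integral_integral_swap (f := fun u τ => k u τ * (φ u * G τ)) hint
  simp_rw [← integral_mul_const, ← integral_const_mul]
  calc _ = ∫ u, ∫ τ, k u τ * (φ u * G τ) := by
        congr 1; ext u; congr 1; ext τ; ring
    _ = _ := this
    _ = _ := by congr 1; ext τ; congr 1; ext u; ring

/-- An oscillating Gaussian is, as a tempered distribution, the Fourier transform of an oscillating
Gaussian. This is the limit of the same identity for the Gaussians of parameter `δ - iκ`. -/
theorem integral_cexp_quadratic_mul_oscInt {ψ : ℝ → ℂ} (h : IsTestFunction ψ) {b : ℝ} (hb : b ≠ 0)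
    {κ : ℝ} (hκ : κ ≠ 0) (lam : ℝ) :
    ∫ τ : ℝ, cexp (I * ((κ * τ ^ 2 + lam * τ : ℝ) : ℂ)) * oscInt ψ (b * τ)
      = ∫ u, ψ u * gaussFT (-(I * κ)) (lam - b * u) := by
  have hz : Tendsto (fun δ : ℝ => (δ : ℂ) - I * κ) (𝓝[>] 0) (𝓝 (-(I * κ))) := by
    have : Continuous fun δ : ℝ => (δ : ℂ) - I * κ := by fun_prop
    have h := this.tendsto 0
    simp only [ofReal_zero, zero_sub] at h
    exact h.mono_left nhdsWithin_le_nhds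
  have hz₀ : 0 ≤ (-(I * κ)).re ∧ -(I * κ) ≠ 0 := by simp [hκ]
  have hre : ∀ᶠ δ : ℝ in 𝓝[>] 0, 0 ≤ ((δ : ℂ) - I * κ).re ∧ (δ : ℂ) - I * κ ≠ 0 := by
    filter_upwards [self_mem_nhdsWithin] with δ hδ
    have hδ : 0 < δ := hδ
    have : 0 < ((δ : ℂ) - I * κ).re := by simpa
    exact ⟨this.le, fun h0 => by simp [h0] at this⟩
  have hψ := h.continuous
  have hosc := continuous_oscInt h
  have hL : Tendsto (fun δ : ℝ => ∫ τ : ℝ, (cexp (I * lam * τ) * cexp (-(δ - I * κ) * τ ^ 2)) *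
      oscInt ψ (b * τ)) (𝓝[>] 0)
      (𝓝 (∫ τ : ℝ, cexp (I * ((κ * τ ^ 2 + lam * τ : ℝ) : ℂ)) * oscInt ψ (b * τ))) := by
    refine tendsto_integral_filter_of_dominated_convergence (fun τ => ‖oscInt ψ (b * τ)‖)
      (Eventually.of_forall fun δ => Continuous.aestronglyMeasurable (by fun_prop)) ?_
      (integrable_oscInt h hb).norm (Eventually.of_forall fun τ => Tendsto.mul_const _ ?_)
    · filter_upwards [self_mem_nhdsWithin] with δ hδ
      refine Eventually.of_forall fun τ => ?_
      rw [norm_mul]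
      refine mul_le_of_le_one_left (norm_nonneg _) ?_
      rw [← Complex.exp_add, Complex.norm_exp, Real.exp_le_one_iff]
      have hδ : 0 < δ := hδ
      have : (I * lam * τ + -(δ - I * κ) * τ ^ 2 : ℂ).re = -(δ * τ ^ 2) := by
        have : (I * lam * τ + -(δ - I * κ) * τ ^ 2 : ℂ)
          = ((-(δ * τ ^ 2) : ℝ) : ℂ) + ((lam * τ + κ * τ ^ 2 : ℝ) : ℂ) * I := by
          push_cast; ring
        rw [this, add_re, ofReal_re, re_ofReal_mul, I_re]; ring
      rw [this, neg_nonpos]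
      positivity
    · have : Continuous fun δ : ℝ => cexp (I * lam * τ) * cexp (-(δ - I * κ) * τ ^ 2) := by
        fun_prop
      have h := this.tendsto 0
      have h0 : cexp (I * lam * τ) * cexp (-((0 : ℝ) - I * κ) * τ ^ 2)
          = cexp (I * ((κ * τ ^ 2 + lam * τ : ℝ) : ℂ)) := by
        rw [← Complex.exp_add]; congr 1; push_cast; ring
      rw [h0] at h
      exact h.mono_left nhdsWithin_le_nhds
  have hR : Tendsto (fun δ : ℝ => ∫ u, ψ u * gaussFT (δ - I * κ) (lam - b * u)) (𝓝[>] 0)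
      (𝓝 (∫ u, ψ u * gaussFT (-(I * κ)) (lam - b * u))) := by
    have hbd : ∀ᶠ δ : ℝ in 𝓝[>] 0, √(Real.pi / ‖(δ : ℂ) - I * κ‖) ≤
        √(Real.pi / ‖-(I * κ)‖) + 1 := by
      have : Tendsto (fun δ : ℝ => √(Real.pi / ‖(δ : ℂ) - I * κ‖)) (𝓝[>] 0)
          (𝓝 (√(Real.pi / ‖-(I * κ)‖))) :=
        (tendsto_const_nhds.div hz.norm (norm_ne_zero_iff.2 hz₀.2)).sqrt
      exact this.eventually_le_const (by linarith)
    refine tendsto_integral_filter_of_dominated_convergence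
      (fun u => ‖ψ u‖ * (√(Real.pi / ‖-(I * κ)‖) + 1)) ?_ ?_ (h.integrable.norm.mul_const _) ?_
    · refine Eventually.of_forall fun δ => Continuous.aestronglyMeasurable ?_
      exact hψ.mul ((continuous_gaussFT _).comp (by fun_prop))
    · filter_upwards [hre, hbd] with δ h1 h2
      refine Eventually.of_forall fun u => ?_
      rw [norm_mul]
      gcongr
      exact (norm_gaussFT_le h1.1 _).trans h2
    · exact Eventually.of_forall fun u =>
        (tendsto_gaussFT hz tendsto_const_nhds hz₀ hre).const_mul _
  refine tendsto_nhds_unique hL (hR.congr' ?_)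
  filter_upwards [self_mem_nhdsWithin] with δ hδ
  have hδ : 0 < δ := hδ
  have hp : 0 < ((δ : ℂ) - I * κ).re := by simpa
  have hG : Integrable fun τ : ℝ => cexp (I * lam * τ) * cexp (-(δ - I * κ) * τ ^ 2) := by
    refine (integrable_cexp_quadratic hp (I * lam) 0).congr (Eventually.of_forall fun τ => ?_)
    simp only
    rw [← Complex.exp_add]
    congr 1
    ring
  have := integral_kernel_swap (k := fun u τ : ℝ => cexp (I * ((-(b * τ * u) : ℝ) : ℂ))) (C := 1)
    hG h.integrable (by fun_prop) (fun u τ => (Complex.norm_exp_I_mul_ofReal _).le)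
  simp only [oscInt]
  simp_rw [mul_comm (ψ _)]
  rw [← this]
  congr 1; ext u
  congr 1
  rw [← integral_cexp_eq_gaussFT hp]
  congr 1; ext τ
  simp only [← Complex.exp_add]
  congr 1
  push_cast
  ring

/-! ### Impulses of distributions -/

theorem IsTestFunction.comp_scale {φ : ℝ → ℂ} (h : IsTestFunction φ) (u : ℝ) {r : ℝ}
    (hr : r ≠ 0) : IsTestFunction fun v => φ ((v - u) / r) := by
  refine ⟨h.1.comp (by fun_prop), ?_⟩
  have e : (fun v => φ ((v - u) / r))
      = φ ∘ ((Homeomorph.subRight u).trans (Homeomorph.mulRight₀ r⁻¹ (inv_ne_zero hr))) := by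
    ext v; simp [div_eq_mul_inv]
  rw [e]
  exact h.2.comp_homeomorph _

/-- A test function that detects the strength of an impulse. -/
theorem exists_isTestFunction_eq_one : ∃ φ : ℝ → ℂ, IsTestFunction φ ∧ φ 0 = 1 := by
  let f : ContDiffBump (0 : ℝ) := default
  have h1 : ContDiff ℝ (⊤ : ℕ∞) (fun x => ((f x : ℝ) : ℂ)) :=
    Complex.ofRealCLM.contDiff.comp f.contDiff
  have h2 : HasCompactSupport (fun x => ((f x : ℝ) : ℂ)) :=
    f.hasCompactSupport.comp_left Complex.ofReal_zero
  refine ⟨_, ⟨h1, h2⟩, ?_⟩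
  rw [f.one_of_mem_closedBall (Metric.mem_closedBall_self f.rIn_pos.le), Complex.ofReal_one]

theorem HasImpulse.unique {W : (ℝ → ℂ) → ℂ} {u : ℝ} {c₁ c₂ : ℂ} (h₁ : HasImpulse W u c₁)
    (h₂ : HasImpulse W u c₂) : c₁ = c₂ := by
  obtain ⟨φ, hφ, h0⟩ := exists_isTestFunction_eq_one
  simpa [h0] using tendsto_nhds_unique (h₁ φ hφ) (h₂ φ hφ)

/-- A distribution given by a bounded function has no impulses, since the scaled test functions
tend to zero in `L¹`. -/
theorem hasImpulse_zero_of_bounded {W : (ℝ → ℂ) → ℂ} {g : ℝ → ℂ} {C : ℝ}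
    (hg : ∀ v, ‖g v‖ ≤ C) (hW : ∀ φ, IsTestFunction φ → W φ = ∫ v, φ v * g v) (u : ℝ) :
    HasImpulse W u 0 := by
  intro φ hφ
  rw [zero_mul]
  have hlim : Tendsto (fun r : ℝ => |r| * (∫ v, ‖φ v‖) * C) (𝓝[>] 0) (𝓝 0) := by
    have : Continuous fun r : ℝ => |r| * (∫ v, ‖φ v‖) * C := by fun_prop
    have h := this.tendsto 0
    simp only [abs_zero, zero_mul] at h
    exact h.mono_left nhdsWithin_le_nhds
  refine squeeze_zero_norm' ?_ hlim
  filter_upwards [self_mem_nhdsWithin] with r hr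
  have hr : 0 < r := hr
  have ht := hφ.comp_scale u hr.ne'
  rw [hW _ ht]
  calc ‖∫ v, φ ((v - u) / r) * g v‖ ≤ ∫ v, ‖φ ((v - u) / r)‖ * C := by
        refine norm_integral_le_of_norm_le (ht.integrable.norm.mul_const C)
          (Eventually.of_forall fun v => ?_)
        rw [norm_mul]
        gcongr
        exact hg v
    _ = |r| * (∫ v, ‖φ v‖) * C := by
        rw [integral_mul_const, integral_sub_right_eq_self (fun v => ‖φ (v / r)‖) u,
          Measure.integral_comp_div (fun v => ‖φ v‖) r, smul_eq_mul]

theorem hasImpulse_of_eval {W : (ℝ → ℂ) → ℂ} {u₀ : ℝ} {c : ℂ}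
    (hW : ∀ φ, IsTestFunction φ → W φ = c * φ u₀) (u : ℝ) :
    HasImpulse W u (if u = u₀ then c else 0) := by
  intro φ hφ
  have key : ∀ᶠ r : ℝ in 𝓝[>] 0, W (fun v => φ ((v - u) / r)) = c * φ ((u₀ - u) / r) := by
    filter_upwards [self_mem_nhdsWithin] with r hr
    exact hW _ (hφ.comp_scale u (ne_of_gt hr))
  refine Tendsto.congr' (EventuallyEq.symm key) ?_
  split_ifs with h
  · simp [h]
  · rw [zero_mul]
    -- for `u ≠ u₀` the scaled test functions vanish at `u₀` as soon as `r` is small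
    obtain ⟨R, hR⟩ := hφ.2.isCompact.isBounded.subset_closedBall 0
    have hd : 0 < |u₀ - u| := abs_pos.2 (sub_ne_zero.2 (Ne.symm h))
    have hlt : ∀ᶠ r : ℝ in 𝓝[>] 0, |R| * r < |u₀ - u| := by
      have : Continuous fun r : ℝ => |R| * r := by fun_prop
      have h := (this.tendsto 0).mono_left (nhdsWithin_le_nhds (s := Set.Ioi 0))
      rw [mul_zero] at h
      exact h.eventually_lt_const hd
    refine Tendsto.congr' ?_ tendsto_const_nhds
    filter_upwards [self_mem_nhdsWithin, hlt] with r hr hlt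
    have hr : 0 < r := hr
    have : (u₀ - u) / r ∉ tsupport φ := by
      intro hm
      have := hR hm
      rw [Metric.mem_closedBall, dist_zero_right, Real.norm_eq_abs, abs_div, abs_of_pos hr,
        div_le_iff₀ hr] at this
      have h2 : R * r ≤ |R| * r := by gcongr; exact le_abs_self R
      linarith
    rw [image_eq_zero_of_notMem_tsupport this, mul_zero]

/-! ### The kernels of the distribution paired with a test function -/

/-- The constant `(i2πb)^(-1/2)` of the kernel of the linear canonical transform. -/
def lctConst (A : Matrix.SpecialLinearGroup (Fin 2) ℝ) : ℂ :=
  1 / (I * 2 * Real.pi * (A 0 1 : ℝ)) ^ (1 / 2 : ℂ)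

theorem norm_lctConst (A : Matrix.SpecialLinearGroup (Fin 2) ℝ) :
    ‖lctConst A‖ = 1 / √(2 * Real.pi * |A 0 1|) := by
  rw [lctConst, norm_div, norm_one, norm_cpow_half]
  simp [abs_of_pos Real.pi_pos]

theorem lctConst_ne_zero {A : Matrix.SpecialLinearGroup (Fin 2) ℝ} (hA : A 0 1 ≠ 0) :
    lctConst A ≠ 0 := by
  rw [← norm_ne_zero_iff, norm_lctConst]
  have := Real.pi_pos
  have := abs_pos.2 hA
  positivity

theorem lctKernel_eq (A : Matrix.SpecialLinearGroup (Fin 2) ℝ) (u t : ℝ) :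
    lctKernel A u t = lctConst A * cexp (I * ((A 1 1 / (2 * A 0 1) * u ^ 2 - 1 / A 0 1 * u * t
      + A 0 0 / (2 * A 0 1) * t ^ 2 : ℝ) : ℂ)) := rfl

theorem norm_lctKernel (A : Matrix.SpecialLinearGroup (Fin 2) ℝ) (u t : ℝ) :
    ‖lctKernel A u t‖ = ‖lctConst A‖ := by
  rw [lctKernel_eq, norm_mul, Complex.norm_exp_I_mul_ofReal, mul_one]

theorem continuous_lctKernel (A : Matrix.SpecialLinearGroup (Fin 2) ℝ) :
    Continuous fun p : ℝ × ℝ => lctKernel A p.1 p.2 := by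
  unfold lctKernel
  fun_prop

theorem conj_cexp_I_mul (x : ℝ) : conj (cexp (I * (x : ℂ))) = cexp (I * ((-x : ℝ) : ℂ)) := by
  rw [← Complex.exp_conj, map_mul, Complex.conj_I, Complex.conj_ofReal]
  congr 1; push_cast; ring

/-- The chirp in `u` that remains of `K_{A₁}(u,t+τ/2) K_{A₂}^*(u,t-τ/2)` when the factors that
depend on `τ` are split off. -/
def residualChirp (A₁ A₂ : Matrix.SpecialLinearGroup (Fin 2) ℝ) (t u : ℝ) : ℂ :=
  cexp (I * (((A₁ 1 1 / (2 * A₁ 0 1) - A₂ 1 1 / (2 * A₂ 0 1)) * u ^ 2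
    - (1 / A₁ 0 1 - 1 / A₂ 0 1) * t * u : ℝ) : ℂ))

/-- The quadratic phase in `τ` of `K_{A₁}(u,t+τ/2) K_{A₂}^*(u,t-τ/2)`. -/
def lagPhase (A₁ A₂ : Matrix.SpecialLinearGroup (Fin 2) ℝ) (t τ : ℝ) : ℝ :=
  A₁ 0 0 / (2 * A₁ 0 1) * (t + τ / 2) ^ 2 - A₂ 0 0 / (2 * A₂ 0 1) * (t - τ / 2) ^ 2

theorem norm_residualChirp (A₁ A₂ : Matrix.SpecialLinearGroup (Fin 2) ℝ) (t u : ℝ) :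
    ‖residualChirp A₁ A₂ t u‖ = 1 := Complex.norm_exp_I_mul_ofReal _

theorem contDiff_residualChirp (A₁ A₂ : Matrix.SpecialLinearGroup (Fin 2) ℝ) (t : ℝ) :
    ContDiff ℝ (⊤ : ℕ∞) (residualChirp A₁ A₂ t) := by
  unfold residualChirp
  have h : ContDiff ℝ (⊤ : ℕ∞) fun u : ℝ => (A₁ 1 1 / (2 * A₁ 0 1) - A₂ 1 1 / (2 * A₂ 0 1)) * u ^ 2
      - (1 / A₁ 0 1 - 1 / A₂ 0 1) * t * u := by fun_prop
  exact ContDiff.cexp (contDiff_const.mul (Complex.ofRealCLM.contDiff.comp h))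

theorem IsTestFunction.mul_residualChirp {φ : ℝ → ℂ} (h : IsTestFunction φ)
    (A₁ A₂ : Matrix.SpecialLinearGroup (Fin 2) ℝ) (t : ℝ) :
    IsTestFunction fun u => φ u * residualChirp A₁ A₂ t u :=
  ⟨h.1.mul (contDiff_residualChirp A₁ A₂ t), h.2.mul_right⟩

theorem lctKernel_mul_conj (A₁ A₂ : Matrix.SpecialLinearGroup (Fin 2) ℝ) (t τ u : ℝ) :
    lctKernel A₁ u (t + τ / 2) * conj (lctKernel A₂ u (t - τ / 2))
      = lctConst A₁ * conj (lctConst A₂) * cexp (I * (lagPhase A₁ A₂ t τ : ℂ)) *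
        (residualChirp A₁ A₂ t u *
          cexp (I * ((-((1 / A₁ 0 1 + 1 / A₂ 0 1) / 2 * τ * u) : ℝ) : ℂ))) := by
  rw [lctKernel_eq, lctKernel_eq, map_mul, conj_cexp_I_mul, residualChirp, mul_mul_mul_comm,
    mul_assoc (lctConst A₁ * _)]
  simp only [← Complex.exp_add, ← mul_add, ← Complex.ofReal_add]
  congr 4
  unfold lagPhase
  ring

/-- The function `τ ↦ ∫ K_{A₁}(u,t+τ/2) K_{A₂}^*(u,t-τ/2) φ(u) du` against which the products of
linear canonical transforms are integrated. -/
def kernelPairing (A₁ A₂ : Matrix.SpecialLinearGroup (Fin 2) ℝ) (φ : ℝ → ℂ) (t τ : ℝ) : ℂ :=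
  ∫ u, lctKernel A₁ u (t + τ / 2) * conj (lctKernel A₂ u (t - τ / 2)) * φ u

theorem kernelPairing_eq (A₁ A₂ : Matrix.SpecialLinearGroup (Fin 2) ℝ) (φ : ℝ → ℂ) (t τ : ℝ) :
    kernelPairing A₁ A₂ φ t τ
      = lctConst A₁ * conj (lctConst A₂) * cexp (I * (lagPhase A₁ A₂ t τ : ℂ)) *
        oscInt (fun u => φ u * residualChirp A₁ A₂ t u) ((1 / A₁ 0 1 + 1 / A₂ 0 1) / 2 * τ) := by
  simp_rw [kernelPairing, lctKernel_mul_conj, oscInt]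
  rw [← integral_const_mul]
  congr 1; ext u
  ring

theorem continuous_lagPhase (A₁ A₂ : Matrix.SpecialLinearGroup (Fin 2) ℝ) (t : ℝ) :
    Continuous (lagPhase A₁ A₂ t) := by
  unfold lagPhase
  fun_prop

section
variable {A₁ A₂ : Matrix.SpecialLinearGroup (Fin 2) ℝ} {φ : ℝ → ℂ}

theorem continuous_kernelPairing (h : IsTestFunction φ) (t : ℝ) :
    Continuous (kernelPairing A₁ A₂ φ t) := by
  rw [funext (kernelPairing_eq A₁ A₂ φ t)]
  have := continuous_oscInt (h.mul_residualChirp A₁ A₂ t)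
  have := continuous_lagPhase A₁ A₂ t
  fun_prop

theorem norm_kernelPairing (t τ : ℝ) :
    ‖kernelPairing A₁ A₂ φ t τ‖ = ‖lctConst A₁‖ * ‖lctConst A₂‖ *
      ‖oscInt (fun u => φ u * residualChirp A₁ A₂ t u) ((1 / A₁ 0 1 + 1 / A₂ 0 1) / 2 * τ)‖ := by
  rw [kernelPairing_eq, norm_mul, norm_mul, norm_mul, Complex.norm_exp_I_mul_ofReal, mul_one,
    RCLike.norm_conj]

theorem norm_kernelPairing_le (t τ : ℝ) :
    ‖kernelPairing A₁ A₂ φ t τ‖ ≤ ‖lctConst A₁‖ * ‖lctConst A₂‖ * ∫ u, ‖φ u‖ := by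
  rw [norm_kernelPairing]
  gcongr
  refine (norm_oscInt_le _ _).trans (le_of_eq ?_)
  simp_rw [norm_mul, norm_residualChirp, mul_one]

theorem integrable_kernelPairing (h : IsTestFunction φ) (hA : 1 / A₁ 0 1 + 1 / A₂ 0 1 ≠ 0)
    (t : ℝ) : Integrable (kernelPairing A₁ A₂ φ t) := by
  refine ((integrable_oscInt (h.mul_residualChirp A₁ A₂ t)
    (div_ne_zero hA two_ne_zero)).norm.const_mul (‖lctConst A₁‖ * ‖lctConst A₂‖)).mono'
    (continuous_kernelPairing h t).aestronglyMeasurable (Eventually.of_forall fun τ => ?_)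
  rw [norm_kernelPairing]

/-- If the total phase in `τ` is linear, then the pairing is a point evaluation of `φ`. -/
theorem integral_mul_kernelPairing_linear (h : IsTestFunction φ)
    (hA : 1 / A₁ 0 1 + 1 / A₂ 0 1 ≠ 0) (t : ℝ) {G : ℝ → ℂ} {Γ : ℂ} {lam : ℝ}
    (hG : ∀ τ, G τ * cexp (I * (lagPhase A₁ A₂ t τ : ℂ)) = Γ * cexp (I * ((lam * τ : ℝ) : ℂ))) :
    ∫ τ, G τ * kernelPairing A₁ A₂ φ t τ
      = Γ * (lctConst A₁ * conj (lctConst A₂)) *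
        ((4 * Real.pi / |1 / A₁ 0 1 + 1 / A₂ 0 1| : ℝ) : ℂ) *
        residualChirp A₁ A₂ t (lam / ((1 / A₁ 0 1 + 1 / A₂ 0 1) / 2)) *
        φ (lam / ((1 / A₁ 0 1 + 1 / A₂ 0 1) / 2)) := by
  have key := integral_cexp_mul_oscInt (h.mul_residualChirp A₁ A₂ t)
    (div_ne_zero hA two_ne_zero) lam
  have hc : 2 * Real.pi / |(1 / A₁ 0 1 + 1 / A₂ 0 1) / 2|
      = 4 * Real.pi / |1 / A₁ 0 1 + 1 / A₂ 0 1| := by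
    rw [abs_div, abs_two]
    field_simp
    ring
  rw [hc] at key
  calc _ = ∫ τ : ℝ, Γ * (lctConst A₁ * conj (lctConst A₂)) * (cexp (I * ((lam * τ : ℝ) : ℂ)) *
        oscInt (fun u => φ u * residualChirp A₁ A₂ t u)
          ((1 / A₁ 0 1 + 1 / A₂ 0 1) / 2 * τ)) := by
        congr 1; ext τ
        rw [kernelPairing_eq]
        linear_combination (lctConst A₁ * conj (lctConst A₂)) *
          oscInt (fun u => φ u * residualChirp A₁ A₂ t u)
          ((1 / A₁ 0 1 + 1 / A₂ 0 1) / 2 * τ) * hG τ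
    _ = _ := by
      rw [integral_const_mul, key]
      ring

/-- If the total phase in `τ` is quadratic, then the pairing is integration of `φ` against a
bounded function of constant modulus. -/
theorem integral_mul_kernelPairing_quadratic (h : IsTestFunction φ)
    (hA : 1 / A₁ 0 1 + 1 / A₂ 0 1 ≠ 0) (t : ℝ) {G : ℝ → ℂ} {Γ : ℂ} {κ lam : ℝ} (hκ : κ ≠ 0)
    (hG : ∀ τ, G τ * cexp (I * (lagPhase A₁ A₂ t τ : ℂ))
      = Γ * cexp (I * ((κ * τ ^ 2 + lam * τ : ℝ) : ℂ))) :
    ∫ τ, G τ * kernelPairing A₁ A₂ φ t τ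
      = ∫ u, φ u * (Γ * (lctConst A₁ * conj (lctConst A₂)) * residualChirp A₁ A₂ t u *
        gaussFT (-(I * κ)) (lam - (1 / A₁ 0 1 + 1 / A₂ 0 1) / 2 * u)) := by
  have key := integral_cexp_quadratic_mul_oscInt (h.mul_residualChirp A₁ A₂ t)
    (div_ne_zero hA two_ne_zero) hκ lam
  calc _ = ∫ τ : ℝ, Γ * (lctConst A₁ * conj (lctConst A₂)) *
        (cexp (I * ((κ * τ ^ 2 + lam * τ : ℝ) : ℂ)) *
        oscInt (fun u => φ u * residualChirp A₁ A₂ t u)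
          ((1 / A₁ 0 1 + 1 / A₂ 0 1) / 2 * τ)) := by
        congr 1; ext τ
        rw [kernelPairing_eq]
        linear_combination (lctConst A₁ * conj (lctConst A₂)) *
          oscInt (fun u => φ u * residualChirp A₁ A₂ t u)
          ((1 / A₁ 0 1 + 1 / A₂ 0 1) / 2 * τ) * hG τ
    _ = _ := by
      rw [integral_const_mul, key, ← integral_const_mul]
      congr 1; ext u
      ring

end

theorem norm_gaussFT_neg_I_mul (q w : ℝ) : ‖gaussFT (-(I * q)) w‖ = √(Real.pi / |q|) := by
  rw [norm_gaussFT_of_re_eq_zero (by simp)]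
  simp

theorem gaussFT_neg_I_mul (q w : ℝ) :
    gaussFT (-(I * q)) w
      = (Real.pi / (-(I * q))) ^ (1 / 2 : ℂ) * cexp (I * ((-(w ^ 2 / (4 * q)) : ℝ) : ℂ)) := by
  rw [gaussFT]
  congr 2
  push_cast
  by_cases hq : q = 0
  · simp [hq]
  · have : (q : ℂ) ≠ 0 := by exact_mod_cast hq
    field_simp
    simp

/-! ### The transforms of windowed chirps -/

/-- The transform of a windowed chirp. The Gaussian parameter `z` collects the window, the chirp
rate of the signal and the chirp in `s` of the kernel. -/
def chirpLCT (B : Matrix.SpecialLinearGroup (Fin 2) ℝ) (m : ℝ) (z : ℂ) (x : ℝ) : ℂ :=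
  lctConst B * cexp (I * ((B 1 1 / (2 * B 0 1) * x ^ 2 : ℝ) : ℂ)) * gaussFT z (m - x / B 0 1)

/-- The chirp rate `n + a/(2b)` of the product of the signal with the kernel. -/
def innerRate (n : ℝ) (B : Matrix.SpecialLinearGroup (Fin 2) ℝ) : ℝ := n + B 0 0 / (2 * B 0 1)

theorem chirpInv_eq {B : Matrix.SpecialLinearGroup (Fin 2) ℝ} (hB : B 0 1 ≠ 0) (n : ℝ) :
    chirpInv n B = 2 * B 0 1 * innerRate n B := by
  unfold chirpInv innerRate
  field_simp

theorem chirpInv_ne_zero_iff {B : Matrix.SpecialLinearGroup (Fin 2) ℝ} (hB : B 0 1 ≠ 0) (n : ℝ) :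
    chirpInv n B ≠ 0 ↔ innerRate n B ≠ 0 := by
  simp [chirpInv_eq hB, hB]

theorem lct_gaussWindow_mul_lfm {B : Matrix.SpecialLinearGroup (Fin 2) ℝ} (hB : B 0 1 ≠ 0)
    (m n : ℝ) {ε : ℝ} (hε : 0 < ε) (x : ℝ) :
    lct B (fun s => gaussWindow ε s * lfm m n s) x
      = chirpLCT B m (ε - I * innerRate n B) x := by
  rw [lct, if_neg hB, chirpLCT, ← integral_cexp_eq_gaussFT (by simpa using hε),
    ← integral_const_mul]
  congr 1; ext s
  rw [gaussWindow, lfm, lctKernel_eq]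
  rw [mul_left_comm, mul_assoc (lctConst B)]
  simp only [← Complex.exp_add]
  congr 2
  unfold innerRate
  push_cast
  ring

theorem continuous_chirpLCT (B : Matrix.SpecialLinearGroup (Fin 2) ℝ) (m : ℝ) (z : ℂ) :
    Continuous (chirpLCT B m z) := by
  unfold chirpLCT
  have := continuous_gaussFT z
  fun_prop

theorem norm_chirpLCT (B : Matrix.SpecialLinearGroup (Fin 2) ℝ) (m : ℝ) (z : ℂ) (x : ℝ) :
    ‖chirpLCT B m z x‖ = ‖lctConst B‖ * ‖gaussFT z (m - x / B 0 1)‖ := by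
  rw [chirpLCT, norm_mul, norm_mul, Complex.norm_exp_I_mul_ofReal, mul_one]

/-- The bound does not depend on the width `ε` of the window. -/
theorem norm_chirpLCT_le (B : Matrix.SpecialLinearGroup (Fin 2) ℝ) (m : ℝ) {q : ℝ} (hq : q ≠ 0)
    {ε : ℝ} (hε : 0 ≤ ε) (x : ℝ) :
    ‖chirpLCT B m (ε - I * q) x‖ ≤ ‖lctConst B‖ * √(Real.pi / |q|) := by
  rw [norm_chirpLCT]
  gcongr
  refine (norm_gaussFT_le (by simpa using hε) _).trans ?_
  have h1 : |q| ≤ ‖(ε : ℂ) - I * q‖ := by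
    have := Complex.abs_im_le_norm ((ε : ℂ) - I * q)
    simpa using this
  have := abs_pos.2 hq
  have := Real.pi_pos
  gcongr

theorem norm_chirpLCT_le' (B : Matrix.SpecialLinearGroup (Fin 2) ℝ) (m : ℝ) {z : ℂ}
    (hz : 0 ≤ z.re) (x : ℝ) :
    ‖chirpLCT B m z x‖ ≤ ‖lctConst B‖ * √(Real.pi / ‖z‖) := by
  rw [norm_chirpLCT]
  gcongr
  exact norm_gaussFT_le hz _

theorem tendsto_chirpLCT (B : Matrix.SpecialLinearGroup (Fin 2) ℝ) (m : ℝ) {q : ℝ} (hq : q ≠ 0)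
    {ι : Type*} {F : Filter ι} {ε x : ι → ℝ} {x₀ : ℝ} (hε : Tendsto ε F (𝓝[>] 0))
    (hx : Tendsto x F (𝓝 x₀)) :
    Tendsto (fun i => chirpLCT B m (ε i - I * q) (x i)) F (𝓝 (chirpLCT B m (-(I * q)) x₀)) := by
  unfold chirpLCT
  have hε' := tendsto_nhdsWithin_iff.1 hε
  refine Tendsto.mul (Tendsto.const_mul _ ?_) (tendsto_gaussFT ?_ ?_ (by simp [hq]) ?_)
  · have : Continuous fun x : ℝ => cexp (I * ((B 1 1 / (2 * B 0 1) * x ^ 2 : ℝ) : ℂ)) := by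
      fun_prop
    exact (this.tendsto x₀).comp hx
  · have : Continuous fun e : ℝ => (e : ℂ) - I * q := by fun_prop
    have h := (this.tendsto 0).comp hε'.1
    rwa [Complex.ofReal_zero, zero_sub] at h
  · exact tendsto_const_nhds.sub (hx.div_const _)
  · filter_upwards [hε'.2] with i hi
    have hi : 0 < ε i := hi
    have : 0 < ((ε i : ℂ) - I * q).re := by simpa
    exact ⟨this.le, fun h0 => by simp [h0] at this⟩

/-! ### The distribution of the chirp signal -/

section
variable {B₁ B₂ A₁ A₂ : Matrix.SpecialLinearGroup (Fin 2) ℝ}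

/-- The product of the transforms of the signal at the times `t ± τ/2`. -/
def chirpProd (B₁ B₂ : Matrix.SpecialLinearGroup (Fin 2) ℝ) (m : ℝ) (z₁ z₂ : ℂ) (t τ : ℝ) : ℂ :=
  chirpLCT B₁ m z₁ (t + τ / 2) * conj (chirpLCT B₂ m z₂ (t - τ / 2))

theorem continuous_chirpProd (m : ℝ) (z₁ z₂ : ℂ) (t : ℝ) :
    Continuous (chirpProd B₁ B₂ m z₁ z₂ t) := by
  unfold chirpProd
  have := continuous_chirpLCT B₁ m z₁
  have := continuous_chirpLCT B₂ m z₂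
  fun_prop

theorem integrable_chirpProd (hB₁ : B₁ 0 1 ≠ 0) (m : ℝ) {z₁ z₂ : ℂ} (hz₁ : 0 < z₁.re)
    (hz₂ : 0 ≤ z₂.re) (t : ℝ) : Integrable (chirpProd B₁ B₂ m z₁ z₂ t) := by
  have hg := (integrable_gaussFT hz₁ (α := -(1 / (2 * B₁ 0 1)))
    (by simpa using hB₁) (m - t / B₁ 0 1)).norm.const_mul
    (‖lctConst B₁‖ * (‖lctConst B₂‖ * √(Real.pi / ‖z₂‖)))
  refine hg.mono' (continuous_chirpProd m z₁ z₂ t).aestronglyMeasurable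
    (Eventually.of_forall fun τ => ?_)
  rw [chirpProd, norm_mul, RCLike.norm_conj, norm_chirpLCT]
  have h1 : m - (t + τ / 2) / B₁ 0 1 = -(1 / (2 * B₁ 0 1)) * τ + (m - t / B₁ 0 1) := by
    field_simp; ring
  rw [h1]
  calc _ ≤ ‖lctConst B₁‖ * ‖gaussFT z₁ (-(1 / (2 * B₁ 0 1)) * τ + (m - t / B₁ 0 1))‖ *
        (‖lctConst B₂‖ * √(Real.pi / ‖z₂‖)) := by
        gcongr
        exact norm_chirpLCT_le' B₂ m hz₂ _
    _ = _ := by ring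

/-- The windowed signal is square-integrable, so the integrals over `u` and `τ` may be exchanged. -/
theorem glwd_pairing (hB₁ : B₁ 0 1 ≠ 0) (hB₂ : B₂ 0 1 ≠ 0) (m n : ℝ) {ε : ℝ} (hε : 0 < ε)
    {φ : ℝ → ℂ} (hφ : IsTestFunction φ) (t : ℝ) :
    ∫ u, glwd B₁ B₂ A₁ A₂ (fun s => gaussWindow ε s * lfm m n s) t u * φ u
      = ∫ τ, chirpProd B₁ B₂ m (ε - I * innerRate n B₁) (ε - I * innerRate n B₂) t τ *
          kernelPairing A₁ A₂ φ t τ := by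
  have hk : Continuous fun p : ℝ × ℝ =>
      lctKernel A₁ p.1 (t + p.2 / 2) * conj (lctKernel A₂ p.1 (t - p.2 / 2)) := by
    have h1 := (continuous_lctKernel A₁).comp
      (f := fun p : ℝ × ℝ => (p.1, t + p.2 / 2)) (by fun_prop)
    have h2 := (continuous_lctKernel A₂).comp
      (f := fun p : ℝ × ℝ => (p.1, t - p.2 / 2)) (by fun_prop)
    exact h1.mul (Complex.continuous_conj.comp h2)
  have := integral_kernel_swap (C := ‖lctConst A₁‖ * ‖lctConst A₂‖)
    (k := fun u τ => lctKernel A₁ u (t + τ / 2) * conj (lctKernel A₂ u (t - τ / 2)))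
    (integrable_chirpProd (B₂ := B₂) hB₁ m (z₁ := ε - I * innerRate n B₁)
      (z₂ := ε - I * innerRate n B₂) (by simpa using hε) (by simpa using hε.le) t)
    hφ.integrable hk (fun u τ => by
      rw [norm_mul, RCLike.norm_conj, norm_lctKernel, norm_lctKernel])
  simp only [glwd, lct_gaussWindow_mul_lfm hB₁ m n hε, lct_gaussWindow_mul_lfm hB₂ m n hε]
  exact this

/-- The distribution of a chirp whose transforms are both chirps: the window may be removed inside
the integral. -/
def chirpDistribution (B₁ B₂ A₁ A₂ : Matrix.SpecialLinearGroup (Fin 2) ℝ) (m n t : ℝ)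
    (φ : ℝ → ℂ) : ℂ :=
  ∫ τ, chirpProd B₁ B₂ m (-(I * innerRate n B₁)) (-(I * innerRate n B₂)) t τ *
    kernelPairing A₁ A₂ φ t τ

theorem HasGLWD.of_tendsto (hB₁ : B₁ 0 1 ≠ 0) (hB₂ : B₂ 0 1 ≠ 0) {m n t : ℝ} {W : (ℝ → ℂ) → ℂ}
    (h : ∀ φ, IsTestFunction φ → Tendsto (fun ε : ℝ => ∫ τ, chirpProd B₁ B₂ m
      (ε - I * innerRate n B₁) (ε - I * innerRate n B₂) t τ * kernelPairing A₁ A₂ φ t τ)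
      (𝓝[>] 0) (𝓝 (W φ))) : HasGLWD B₁ B₂ A₁ A₂ (lfm m n) t W := by
  intro φ hφ
  refine (h φ hφ).congr' ?_
  filter_upwards [self_mem_nhdsWithin] with ε hε
  exact (glwd_pairing hB₁ hB₂ m n hε hφ t).symm

theorem HasGLWD.unique {f : ℝ → ℂ} {t : ℝ} {W W' : (ℝ → ℂ) → ℂ}
    (h : HasGLWD B₁ B₂ A₁ A₂ f t W) (h' : HasGLWD B₁ B₂ A₁ A₂ f t W') {φ : ℝ → ℂ}
    (hφ : IsTestFunction φ) : W φ = W' φ :=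
  tendsto_nhds_unique (h φ hφ) (h' φ hφ)

theorem hasGLWD_chirpDistribution (hB₁ : B₁ 0 1 ≠ 0) (hB₂ : B₂ 0 1 ≠ 0)
    (hA : 1 / A₁ 0 1 + 1 / A₂ 0 1 ≠ 0) {n : ℝ} (h₁ : innerRate n B₁ ≠ 0)
    (h₂ : innerRate n B₂ ≠ 0) (m t : ℝ) :
    HasGLWD B₁ B₂ A₁ A₂ (lfm m n) t (chirpDistribution B₁ B₂ A₁ A₂ m n t) := by
  refine HasGLWD.of_tendsto hB₁ hB₂ fun φ hφ => ?_
  refine tendsto_integral_filter_of_dominated_convergence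
    (fun τ => (‖lctConst B₁‖ * √(Real.pi / |innerRate n B₁|)) *
      (‖lctConst B₂‖ * √(Real.pi / |innerRate n B₂|)) * ‖kernelPairing A₁ A₂ φ t τ‖) ?_ ?_
    ((integrable_kernelPairing hφ hA t).norm.const_mul _) ?_
  · exact Eventually.of_forall fun ε => ((continuous_chirpProd _ _ _ _).mul
      (continuous_kernelPairing hφ t)).aestronglyMeasurable
  · filter_upwards [self_mem_nhdsWithin] with ε hε
    have hε : 0 < ε := hε
    refine Eventually.of_forall fun τ => ?_
    rw [norm_mul, chirpProd, norm_mul, RCLike.norm_conj]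
    gcongr
    · exact norm_chirpLCT_le B₁ m h₁ hε.le _
    · exact norm_chirpLCT_le B₂ m h₂ hε.le _
  · refine Eventually.of_forall fun τ => Tendsto.mul_const _ ?_
    exact (tendsto_chirpLCT B₁ m h₁ tendsto_id tendsto_const_nhds).mul
      ((Complex.continuous_conj.tendsto _).comp
        (tendsto_chirpLCT B₂ m h₂ tendsto_id tendsto_const_nhds))

/-- The phase in `τ` of the integrand of the distribution of a chirp, up to its dependence
on `u`. -/
def signalPhase (B₁ B₂ A₁ A₂ : Matrix.SpecialLinearGroup (Fin 2) ℝ) (m n t τ : ℝ) : ℝ :=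
  (B₁ 1 1 / (2 * B₁ 0 1) * (t + τ / 2) ^ 2
      - (m - (t + τ / 2) / B₁ 0 1) ^ 2 / (4 * innerRate n B₁))
    - (B₂ 1 1 / (2 * B₂ 0 1) * (t - τ / 2) ^ 2
      - (m - (t - τ / 2) / B₂ 0 1) ^ 2 / (4 * innerRate n B₂))
    + lagPhase A₁ A₂ t τ

/-- The coefficient of `t` in the coefficient `signalSlope * t + signalOffset` of `τ` in
`signalPhase`. The impulse at time `t` sits at the `u` where the linear phase of the kernels
cancels this coefficient. -/
def signalSlope (B₁ B₂ A₁ A₂ : Matrix.SpecialLinearGroup (Fin 2) ℝ) (n : ℝ) : ℝ :=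
  B₁ 1 1 / (2 * B₁ 0 1) + B₂ 1 1 / (2 * B₂ 0 1) + A₁ 0 0 / (2 * A₁ 0 1) + A₂ 0 0 / (2 * A₂ 0 1)
    - 1 / (4 * B₁ 0 1 ^ 2 * innerRate n B₁) - 1 / (4 * B₂ 0 1 ^ 2 * innerRate n B₂)

/-- The value at `t = 0` of the coefficient of `τ` in `signalPhase`. -/
def signalOffset (B₁ B₂ : Matrix.SpecialLinearGroup (Fin 2) ℝ) (m n : ℝ) : ℝ :=
  m / (4 * B₁ 0 1 * innerRate n B₁) + m / (4 * B₂ 0 1 * innerRate n B₂)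

/-- The curvature of the phase in `τ` is the number `l`. -/
theorem signalPhase_eq (hB₁ : B₁ 0 1 ≠ 0) (hB₂ : B₂ 0 1 ≠ 0) (hA₁ : A₁ 0 1 ≠ 0) (hA₂ : A₂ 0 1 ≠ 0)
    {n : ℝ} (h₁ : innerRate n B₁ ≠ 0) (h₂ : innerRate n B₂ ≠ 0) (m t τ : ℝ) :
    signalPhase B₁ B₂ A₁ A₂ m n t τ = signalPhase B₁ B₂ A₁ A₂ m n t 0 +
      (chirpL n B₁ B₂ A₁ A₂ * τ ^ 2
        + (signalSlope B₁ B₂ A₁ A₂ n * t + signalOffset B₁ B₂ m n) * τ) := by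
  unfold signalPhase chirpL chirpH lagPhase signalSlope signalOffset
  rw [chirpInv_eq hB₁, chirpInv_eq hB₂]
  generalize innerRate n B₁ = q₁ at *
  generalize innerRate n B₂ = q₂ at *
  field_simp
  ring

/-- The amplitude of the integrand of the distribution of a chirp. -/
def signalAmp (B₁ B₂ A₁ A₂ : Matrix.SpecialLinearGroup (Fin 2) ℝ) (m n t : ℝ) : ℂ :=
  lctConst B₁ * conj (lctConst B₂) * ((Real.pi / (-(I * innerRate n B₁))) ^ (1 / 2 : ℂ) *
    conj ((Real.pi / (-(I * innerRate n B₂))) ^ (1 / 2 : ℂ))) *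
    cexp (I * (signalPhase B₁ B₂ A₁ A₂ m n t 0 : ℂ))

theorem norm_signalAmp (m n t : ℝ) :
    ‖signalAmp B₁ B₂ A₁ A₂ m n t‖ = ‖lctConst B₁‖ * ‖lctConst B₂‖ *
      (√(Real.pi / |innerRate n B₁|) * √(Real.pi / |innerRate n B₂|)) := by
  rw [signalAmp, norm_mul, norm_mul, norm_mul, norm_mul, Complex.norm_exp_I_mul_ofReal,
    RCLike.norm_conj, RCLike.norm_conj, norm_cpow_half, norm_cpow_half]
  simp [abs_of_pos Real.pi_pos]

theorem chirpProd_mul_lagPhase (hB₁ : B₁ 0 1 ≠ 0) (hB₂ : B₂ 0 1 ≠ 0) (hA₁ : A₁ 0 1 ≠ 0)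
    (hA₂ : A₂ 0 1 ≠ 0) {n : ℝ} (h₁ : innerRate n B₁ ≠ 0) (h₂ : innerRate n B₂ ≠ 0) (m t τ : ℝ) :
    chirpProd B₁ B₂ m (-(I * innerRate n B₁)) (-(I * innerRate n B₂)) t τ *
        cexp (I * (lagPhase A₁ A₂ t τ : ℂ))
      = signalAmp B₁ B₂ A₁ A₂ m n t * cexp (I * ((chirpL n B₁ B₂ A₁ A₂ * τ ^ 2
        + (signalSlope B₁ B₂ A₁ A₂ n * t + signalOffset B₁ B₂ m n) * τ : ℝ) : ℂ)) := by
  have hP : cexp (I * (signalPhase B₁ B₂ A₁ A₂ m n t τ : ℂ)) = _ :=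
    congrArg (fun x : ℝ => cexp (I * (x : ℂ))) (signalPhase_eq hB₁ hB₂ hA₁ hA₂ h₁ h₂ m t τ)
  rw [Complex.ofReal_add, mul_add, Complex.exp_add] at hP
  rw [signalAmp, mul_assoc _ (cexp _) (cexp _), ← hP]
  have hQ : cexp (I * (signalPhase B₁ B₂ A₁ A₂ m n t τ : ℂ))
      = cexp (I * ((B₁ 1 1 / (2 * B₁ 0 1) * (t + τ / 2) ^ 2 : ℝ) : ℂ)) *
        cexp (I * ((-((m - (t + τ / 2) / B₁ 0 1) ^ 2 / (4 * innerRate n B₁)) : ℝ) : ℂ)) *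
        (cexp (I * ((-(B₂ 1 1 / (2 * B₂ 0 1) * (t - τ / 2) ^ 2) : ℝ) : ℂ)) *
        cexp (I * ((- -((m - (t - τ / 2) / B₂ 0 1) ^ 2 / (4 * innerRate n B₂)) : ℝ) : ℂ))) *
        cexp (I * (lagPhase A₁ A₂ t τ : ℂ)) := by
    simp only [← Complex.exp_add, ← mul_add, ← Complex.ofReal_add]
    congr 3
    unfold signalPhase
    ring
  rw [hQ, chirpProd, chirpLCT, chirpLCT, gaussFT_neg_I_mul, gaussFT_neg_I_mul, map_mul, map_mul,
    map_mul, conj_cexp_I_mul, conj_cexp_I_mul]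
  ring

theorem chirpDistribution_of_chirpL_eq_zero (hB₁ : B₁ 0 1 ≠ 0) (hB₂ : B₂ 0 1 ≠ 0)
    (hA₁ : A₁ 0 1 ≠ 0) (hA₂ : A₂ 0 1 ≠ 0)
    (hA : 1 / A₁ 0 1 + 1 / A₂ 0 1 ≠ 0) {n : ℝ} (h₁ : innerRate n B₁ ≠ 0)
    (h₂ : innerRate n B₂ ≠ 0) (hl : chirpL n B₁ B₂ A₁ A₂ = 0) (m t : ℝ) :
    ∃ C : ℂ, ‖C‖ = ‖lctConst B₁‖ * ‖lctConst B₂‖ *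
      (√(Real.pi / |innerRate n B₁|) * √(Real.pi / |innerRate n B₂|)) *
      (‖lctConst A₁‖ * ‖lctConst A₂‖) * (4 * Real.pi / |1 / A₁ 0 1 + 1 / A₂ 0 1|) ∧
      ∀ φ, IsTestFunction φ → chirpDistribution B₁ B₂ A₁ A₂ m n t φ
        = C * φ ((signalSlope B₁ B₂ A₁ A₂ n * t + signalOffset B₁ B₂ m n) /
          ((1 / A₁ 0 1 + 1 / A₂ 0 1) / 2)) := by
  refine ⟨_, ?_, fun φ hφ => integral_mul_kernelPairing_linear hφ hA t
    (Γ := signalAmp B₁ B₂ A₁ A₂ m n t)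
    (lam := signalSlope B₁ B₂ A₁ A₂ n * t + signalOffset B₁ B₂ m n) fun τ => ?_⟩
  · have hn : ‖((4 * Real.pi / |1 / A₁ 0 1 + 1 / A₂ 0 1| : ℝ) : ℂ)‖
        = 4 * Real.pi / |1 / A₁ 0 1 + 1 / A₂ 0 1| := by
      rw [Complex.norm_real, Real.norm_of_nonneg]
      have := Real.pi_pos
      positivity
    rw [norm_mul, norm_mul, norm_mul, norm_mul, RCLike.norm_conj, norm_residualChirp, hn,
      norm_signalAmp, mul_one]
  · rw [chirpProd_mul_lagPhase hB₁ hB₂ hA₁ hA₂ h₁ h₂, hl, zero_mul, zero_add]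

theorem chirpDistribution_hasImpulse_zero (hB₁ : B₁ 0 1 ≠ 0) (hB₂ : B₂ 0 1 ≠ 0)
    (hA₁ : A₁ 0 1 ≠ 0) (hA₂ : A₂ 0 1 ≠ 0)
    (hA : 1 / A₁ 0 1 + 1 / A₂ 0 1 ≠ 0) {n : ℝ} (h₁ : innerRate n B₁ ≠ 0)
    (h₂ : innerRate n B₂ ≠ 0) (hl : chirpL n B₁ B₂ A₁ A₂ ≠ 0) (m t u : ℝ) :
    HasImpulse (chirpDistribution B₁ B₂ A₁ A₂ m n t) u 0 := by
  refine hasImpulse_zero_of_bounded (C := ‖signalAmp B₁ B₂ A₁ A₂ m n t‖ *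
      (‖lctConst A₁‖ * ‖lctConst A₂‖) * √(Real.pi / |chirpL n B₁ B₂ A₁ A₂|)) ?_
    (fun φ hφ => integral_mul_kernelPairing_quadratic hφ hA t hl
      (chirpProd_mul_lagPhase hB₁ hB₂ hA₁ hA₂ h₁ h₂ m t)) u
  intro v
  rw [norm_mul, norm_mul, norm_mul, norm_mul, RCLike.norm_conj, norm_residualChirp,
    norm_gaussFT_neg_I_mul, mul_one]

/-! ### Chirps with a concentrated transform -/

/-- The factor of the transform of a chirp with `1/h = 0` that does not depend on the window. -/
def concentratedAmp (B : Matrix.SpecialLinearGroup (Fin 2) ℝ) (x : ℝ) : ℂ :=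
  lctConst B * cexp (I * ((B 1 1 / (2 * B 0 1) * x ^ 2 : ℝ) : ℂ)) * (√Real.pi : ℝ)

theorem norm_concentratedAmp (B : Matrix.SpecialLinearGroup (Fin 2) ℝ) (x : ℝ) :
    ‖concentratedAmp B x‖ = ‖lctConst B‖ * √Real.pi := by
  rw [concentratedAmp, norm_mul, norm_mul, Complex.norm_exp_I_mul_ofReal, mul_one,
    Complex.norm_real, Real.norm_of_nonneg (Real.sqrt_nonneg _)]

theorem continuous_concentratedAmp (B : Matrix.SpecialLinearGroup (Fin 2) ℝ) :
    Continuous (concentratedAmp B) := by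
  unfold concentratedAmp
  fun_prop

theorem chirpLCT_ofReal (B : Matrix.SpecialLinearGroup (Fin 2) ℝ) (m : ℝ) {ε : ℝ} (hε : 0 < ε)
    (x : ℝ) : chirpLCT B m ε x = (((√ε)⁻¹ * Real.exp (-((m - x / B 0 1) ^ 2) / (4 * ε)) : ℝ) : ℂ) *
      concentratedAmp B x := by
  rw [chirpLCT, gaussFT_ofReal hε, concentratedAmp]
  push_cast
  ring

/-- The pairing at a single lag is integration of `φ` against a product of two kernels, which is a
bounded function of `u`. -/
theorem hasImpulse_zero_of_kernelPairing {W : (ℝ → ℂ) → ℂ} {t τ : ℝ} {c : ℂ}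
    (hW : ∀ φ, IsTestFunction φ → W φ = c * kernelPairing A₁ A₂ φ t τ) (u : ℝ) :
    HasImpulse W u 0 := by
  refine hasImpulse_zero_of_bounded (C := ‖c‖ * (‖lctConst A₁‖ * ‖lctConst A₂‖))
    (g := fun v => c * (lctKernel A₁ v (t + τ / 2) * conj (lctKernel A₂ v (t - τ / 2)))) ?_ ?_ u
  · intro v
    rw [norm_mul, norm_mul, RCLike.norm_conj, norm_lctKernel, norm_lctKernel]
  · intro φ hφ
    rw [hW φ hφ, kernelPairing, ← integral_const_mul]
    congr 1; ext v
    ring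

/-- If the first transform concentrates in a point and the second one does not, then the
distribution is a bounded function. -/
theorem exists_hasGLWD_of_left_eq_zero (hB₁ : B₁ 0 1 ≠ 0) (hB₂ : B₂ 0 1 ≠ 0)
    {n : ℝ} (h₁ : innerRate n B₁ = 0) (h₂ : innerRate n B₂ ≠ 0) (m t : ℝ) :
    ∃ W, HasGLWD B₁ B₂ A₁ A₂ (lfm m n) t W ∧ ∀ u, HasImpulse W u 0 := by
  -- the lag at which `t + τ/2` is the point `m b` of concentration, and the decay rate around it
  set τ₀ : ℝ := 2 * (m * B₁ 0 1 - t) with hτ₀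
  set a : ℝ := 1 / (16 * B₁ 0 1 ^ 2) with ha_def
  have ha : 0 < a := by positivity
  refine ⟨fun φ => (√(Real.pi / a) : ℝ) * (concentratedAmp B₁ (t + τ₀ / 2) *
    conj (chirpLCT B₂ m (-(I * innerRate n B₂)) (t - τ₀ / 2)) * kernelPairing A₁ A₂ φ t τ₀),
    HasGLWD.of_tendsto hB₁ hB₂ fun φ hφ => ?_, fun u => ?_⟩
  · have key := tendsto_integral_concentrating ha τ₀
      (‖lctConst B₁‖ * √Real.pi * (‖lctConst B₂‖ * √(Real.pi / |innerRate n B₂|)) *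
        (‖lctConst A₁‖ * ‖lctConst A₂‖ * ∫ u, ‖φ u‖))
      (r := fun ε τ => concentratedAmp B₁ (t + τ / 2) *
        conj (chirpLCT B₂ m (ε - I * innerRate n B₂) (t - τ / 2)) * kernelPairing A₁ A₂ φ t τ)
      (r₀ := concentratedAmp B₁ (t + τ₀ / 2) *
        conj (chirpLCT B₂ m (-(I * innerRate n B₂)) (t - τ₀ / 2)) *
        kernelPairing A₁ A₂ φ t τ₀) ?_ ?_
    · refine key.congr' ?_
      filter_upwards [self_mem_nhdsWithin] with ε hε
      congr 1; ext τ
      rw [chirpProd, h₁, Complex.ofReal_zero, mul_zero, sub_zero, chirpLCT_ofReal B₁ m hε]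
      have : -((m - (t + τ / 2) / B₁ 0 1) ^ 2) / (4 * ε) = -a * (τ - τ₀) ^ 2 / ε := by
        rw [ha_def, hτ₀]
        have : ε ≠ 0 := ne_of_gt hε
        field_simp
        ring
      rw [this]
      ring
    · filter_upwards [self_mem_nhdsWithin] with ε hε
      have hε : 0 < ε := hε
      refine ⟨?_, fun τ => ?_⟩
      · have := continuous_chirpLCT B₂ m (ε - I * innerRate n B₂)
        have := continuous_concentratedAmp B₁
        have := continuous_kernelPairing (A₁ := A₁) (A₂ := A₂) hφ t
        fun_prop
      · rw [norm_mul, norm_mul, RCLike.norm_conj, norm_concentratedAmp]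
        gcongr
        · exact norm_chirpLCT_le B₂ m h₂ hε.le _
        · exact norm_kernelPairing_le _ _
    · have hx : Tendsto (fun p : ℝ × ℝ => p.2) (𝓝[>] 0 ×ˢ 𝓝 τ₀) (𝓝 τ₀) := tendsto_snd
      refine Tendsto.mul (Tendsto.mul ?_ ((Complex.continuous_conj.tendsto _).comp
        (tendsto_chirpLCT B₂ m h₂ tendsto_fst (tendsto_const_nhds.sub (hx.div_const 2)))))
        (((continuous_kernelPairing hφ t).tendsto τ₀).comp hx)
      exact ((continuous_concentratedAmp B₁).tendsto _).comp
        (tendsto_const_nhds.add (hx.div_const 2))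
  · refine hasImpulse_zero_of_kernelPairing (A₁ := A₁) (A₂ := A₂) (t := t) (τ := τ₀)
      (c := (√(Real.pi / a) : ℝ) * (concentratedAmp B₁ (t + τ₀ / 2) *
      conj (chirpLCT B₂ m (-(I * innerRate n B₂)) (t - τ₀ / 2)))) (fun φ _ => ?_) u
    ring

theorem exists_hasGLWD_of_right_eq_zero (hB₁ : B₁ 0 1 ≠ 0) (hB₂ : B₂ 0 1 ≠ 0)
    {n : ℝ} (h₁ : innerRate n B₁ ≠ 0) (h₂ : innerRate n B₂ = 0) (m t : ℝ) :
    ∃ W, HasGLWD B₁ B₂ A₁ A₂ (lfm m n) t W ∧ ∀ u, HasImpulse W u 0 := by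
  -- the lag at which `t - τ/2` is the point `m b` of concentration, and the decay rate around it
  set τ₀ : ℝ := 2 * (t - m * B₂ 0 1) with hτ₀
  set a : ℝ := 1 / (16 * B₂ 0 1 ^ 2) with ha_def
  have ha : 0 < a := by positivity
  refine ⟨fun φ => (√(Real.pi / a) : ℝ) * (chirpLCT B₁ m (-(I * innerRate n B₁)) (t + τ₀ / 2) *
    conj (concentratedAmp B₂ (t - τ₀ / 2)) * kernelPairing A₁ A₂ φ t τ₀),
    HasGLWD.of_tendsto hB₁ hB₂ fun φ hφ => ?_, fun u => ?_⟩
  · have key := tendsto_integral_concentrating ha τ₀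
      (‖lctConst B₁‖ * √(Real.pi / |innerRate n B₁|) * (‖lctConst B₂‖ * √Real.pi) *
        (‖lctConst A₁‖ * ‖lctConst A₂‖ * ∫ u, ‖φ u‖))
      (r := fun ε τ => chirpLCT B₁ m (ε - I * innerRate n B₁) (t + τ / 2) *
        conj (concentratedAmp B₂ (t - τ / 2)) * kernelPairing A₁ A₂ φ t τ)
      (r₀ := chirpLCT B₁ m (-(I * innerRate n B₁)) (t + τ₀ / 2) *
        conj (concentratedAmp B₂ (t - τ₀ / 2)) * kernelPairing A₁ A₂ φ t τ₀) ?_ ?_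
    · refine key.congr' ?_
      filter_upwards [self_mem_nhdsWithin] with ε hε
      congr 1; ext τ
      rw [chirpProd, h₂, Complex.ofReal_zero, mul_zero, sub_zero, chirpLCT_ofReal B₂ m hε,
        map_mul, Complex.conj_ofReal]
      have : -((m - (t - τ / 2) / B₂ 0 1) ^ 2) / (4 * ε) = -a * (τ - τ₀) ^ 2 / ε := by
        rw [ha_def, hτ₀]
        have : ε ≠ 0 := ne_of_gt hε
        field_simp
        ring
      rw [this]
      ring
    · filter_upwards [self_mem_nhdsWithin] with ε hε
      have hε : 0 < ε := hε
      refine ⟨?_, fun τ => ?_⟩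
      · have := continuous_chirpLCT B₁ m (ε - I * innerRate n B₁)
        have := continuous_concentratedAmp B₂
        have := continuous_kernelPairing (A₁ := A₁) (A₂ := A₂) hφ t
        fun_prop
      · rw [norm_mul, norm_mul, RCLike.norm_conj, norm_concentratedAmp]
        gcongr
        · exact norm_chirpLCT_le B₁ m h₁ hε.le _
        · exact norm_kernelPairing_le _ _
    · have hx : Tendsto (fun p : ℝ × ℝ => p.2) (𝓝[>] 0 ×ˢ 𝓝 τ₀) (𝓝 τ₀) := tendsto_snd
      refine Tendsto.mul (Tendsto.mul (tendsto_chirpLCT B₁ m h₁ tendsto_fst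
        (tendsto_const_nhds.add (hx.div_const 2))) ((Complex.continuous_conj.tendsto _).comp ?_))
        (((continuous_kernelPairing hφ t).tendsto τ₀).comp hx)
      exact ((continuous_concentratedAmp B₂).tendsto _).comp
        (tendsto_const_nhds.sub (hx.div_const 2))
  · refine hasImpulse_zero_of_kernelPairing (A₁ := A₁) (A₂ := A₂) (t := t) (τ := τ₀)
      (c := (√(Real.pi / a) : ℝ) * (chirpLCT B₁ m (-(I * innerRate n B₁)) (t + τ₀ / 2) *
      conj (concentratedAmp B₂ (t - τ₀ / 2)))) (fun φ _ => ?_) u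
    ring

theorem contDiff_lctKernel (A : Matrix.SpecialLinearGroup (Fin 2) ℝ) (x : ℝ) :
    ContDiff ℝ (⊤ : ℕ∞) fun u => lctKernel A u x := by
  have h : ContDiff ℝ (⊤ : ℕ∞) fun u : ℝ => A 1 1 / (2 * A 0 1) * u ^ 2 - 1 / A 0 1 * u * x
      + A 0 0 / (2 * A 0 1) * x ^ 2 := by fun_prop
  exact contDiff_const.mul (ContDiff.cexp
    (contDiff_const.mul (Complex.ofRealCLM.contDiff.comp h)))

theorem exists_kernelPairing_ne_zero (hA₁ : A₁ 0 1 ≠ 0) (hA₂ : A₂ 0 1 ≠ 0) (t τ : ℝ) :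
    ∃ φ, IsTestFunction φ ∧ kernelPairing A₁ A₂ φ t τ ≠ 0 := by
  let f : ContDiffBump (0 : ℝ) := default
  have h1 : ContDiff ℝ (⊤ : ℕ∞) (fun x => ((f x : ℝ) : ℂ)) :=
    Complex.ofRealCLM.contDiff.comp f.contDiff
  have h2 : HasCompactSupport (fun x => ((f x : ℝ) : ℂ)) :=
    f.hasCompactSupport.comp_left Complex.ofReal_zero
  have h3 : ContDiff ℝ (⊤ : ℕ∞) fun u =>
      conj (lctKernel A₁ u (t + τ / 2)) * lctKernel A₂ u (t - τ / 2) :=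
    (Complex.conjCLE.contDiff.comp (contDiff_lctKernel A₁ _)).mul (contDiff_lctKernel A₂ _)
  -- the conjugate of the kernel times a bump function pairs to the integral of the bump
  refine ⟨_, ⟨h3.mul h1, h2.mul_left⟩, ?_⟩
  have h4 : kernelPairing A₁ A₂ (fun u => conj (lctKernel A₁ u (t + τ / 2)) *
      lctKernel A₂ u (t - τ / 2) * ((f u : ℝ) : ℂ)) t τ
      = ((‖lctConst A₁‖ ^ 2 * ‖lctConst A₂‖ ^ 2 * ∫ u, f u : ℝ) : ℂ) := by
    rw [kernelPairing, Complex.ofReal_mul, ← integral_complex_ofReal, ← integral_const_mul]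
    congr 1; ext u
    have e1 := Complex.mul_conj' (lctKernel A₁ u (t + τ / 2))
    have e2 := Complex.mul_conj' (lctKernel A₂ u (t - τ / 2))
    rw [norm_lctKernel] at e1 e2
    push_cast
    rw [← e1, ← e2]
    ring
  have h5 := norm_ne_zero_iff.2 (lctConst_ne_zero hA₁)
  have h6 := norm_ne_zero_iff.2 (lctConst_ne_zero hA₂)
  have h7 : (∫ u, f u) ≠ 0 := f.integral_pos.ne'
  refine fun h => ?_
  have h8 := h4.symm.trans h
  rw [Complex.ofReal_eq_zero] at h8
  simp_all

/-- If both transforms concentrate, then they do so at the same lag for one time `t`, where the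
distributions of the windowed chirps diverge like `ε^(-1/2)`. -/
theorem not_hasGLWD_of_both_eq_zero (hB₁ : B₁ 0 1 ≠ 0) (hB₂ : B₂ 0 1 ≠ 0) (hA₁ : A₁ 0 1 ≠ 0)
    (hA₂ : A₂ 0 1 ≠ 0) {n : ℝ} (h₁ : innerRate n B₁ = 0) (h₂ : innerRate n B₂ = 0) (m : ℝ)
    (W : (ℝ → ℂ) → ℂ) :
    ¬ HasGLWD B₁ B₂ A₁ A₂ (lfm m n) (m * (B₁ 0 1 + B₂ 0 1) / 2) W := by
  set t : ℝ := m * (B₁ 0 1 + B₂ 0 1) / 2 with ht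
  set τ₀ : ℝ := m * (B₁ 0 1 - B₂ 0 1) with hτ₀
  intro hW
  obtain ⟨φ, hφ, hne⟩ := exists_kernelPairing_ne_zero hA₁ hA₂ t τ₀
  set a : ℝ := 1 / (16 * B₁ 0 1 ^ 2) + 1 / (16 * B₂ 0 1 ^ 2) with ha_def
  have ha : 0 < a := by positivity
  have hc : Continuous fun τ => concentratedAmp B₁ (t + τ / 2) *
      conj (concentratedAmp B₂ (t - τ / 2)) * kernelPairing A₁ A₂ φ t τ := by
    have := continuous_concentratedAmp B₁
    have := continuous_concentratedAmp B₂
    have := continuous_kernelPairing (A₁ := A₁) (A₂ := A₂) hφ t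
    fun_prop
  have key := tendsto_integral_concentrating ha τ₀
    (‖lctConst B₁‖ * √Real.pi * (‖lctConst B₂‖ * √Real.pi) *
      (‖lctConst A₁‖ * ‖lctConst A₂‖ * ∫ u, ‖φ u‖))
    (r := fun ε τ => concentratedAmp B₁ (t + τ / 2) *
      conj (concentratedAmp B₂ (t - τ / 2)) * kernelPairing A₁ A₂ φ t τ)
    (r₀ := concentratedAmp B₁ (t + τ₀ / 2) *
      conj (concentratedAmp B₂ (t - τ₀ / 2)) * kernelPairing A₁ A₂ φ t τ₀)
    (Eventually.of_forall fun ε => ⟨hc, fun τ => by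
      rw [norm_mul, norm_mul, RCLike.norm_conj, norm_concentratedAmp, norm_concentratedAmp]
      gcongr
      exact norm_kernelPairing_le _ _⟩)
    ((hc.tendsto τ₀).comp tendsto_snd)
  -- The product of the two transforms carries the factor `1/ε`, of which concentration absorbs only
  -- `ε^(-1/2)`. If a limit existed, then multiplying by `√ε` would yield both `0` and `r₀ ≠ 0`.
  have hs : Tendsto (fun ε : ℝ => ((√ε : ℝ) : ℂ)) (𝓝[>] 0) (𝓝 0) := by
    have : Continuous fun ε : ℝ => ((√ε : ℝ) : ℂ) := by fun_prop
    have h := this.tendsto 0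
    rw [Real.sqrt_zero, Complex.ofReal_zero] at h
    exact h.mono_left nhdsWithin_le_nhds
  have h0 := hs.mul (hW φ hφ)
  rw [zero_mul] at h0
  have heq := tendsto_nhds_unique (h0.congr' ?_) key
  · have hn := congrArg norm heq
    rw [norm_zero, norm_mul, norm_mul, norm_mul, RCLike.norm_conj, norm_concentratedAmp,
      norm_concentratedAmp, Complex.norm_real, Real.norm_of_nonneg (Real.sqrt_nonneg _)] at hn
    have h5 := norm_pos_iff.2 (lctConst_ne_zero hB₁)
    have h6 := norm_pos_iff.2 (lctConst_ne_zero hB₂)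
    have h7 := norm_pos_iff.2 hne
    have h8 := Real.pi_pos
    have : 0 < √(Real.pi / a) * (‖lctConst B₁‖ * √Real.pi * (‖lctConst B₂‖ * √Real.pi) *
      ‖kernelPairing A₁ A₂ φ t τ₀‖) := by positivity
    linarith
  · filter_upwards [self_mem_nhdsWithin] with ε hε
    have hε : 0 < ε := hε
    rw [glwd_pairing hB₁ hB₂ m n hε hφ t, ← integral_const_mul]
    congr 1; ext τ
    rw [chirpProd, h₁, h₂, Complex.ofReal_zero, mul_zero, sub_zero, chirpLCT_ofReal B₁ m hε,
      chirpLCT_ofReal B₂ m hε, map_mul, Complex.conj_ofReal]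
    have e : Real.exp (-a * (τ - τ₀) ^ 2 / ε)
        = Real.exp (-((m - (t + τ / 2) / B₁ 0 1) ^ 2) / (4 * ε)) *
          Real.exp (-((m - (t - τ / 2) / B₂ 0 1) ^ 2) / (4 * ε)) := by
      rw [← Real.exp_add]
      congr 1
      rw [ha_def, ht, hτ₀]
      field_simp
      ring
    have hsq : ((√ε : ℝ) : ℂ) ≠ 0 := by
      exact_mod_cast (Real.sqrt_pos.2 hε).ne'
    rw [e]
    push_cast
    field_simp

end

/-! ### The expected distribution of white noise -/

section
variable {B₁ B₂ A₁ A₂ : Matrix.SpecialLinearGroup (Fin 2) ℝ}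

/-- The difference of the chirp rates in `s` of the kernels of `B₁` and `B₂`. -/
def rateGap (B₁ B₂ : Matrix.SpecialLinearGroup (Fin 2) ℝ) : ℝ :=
  B₁ 0 0 / (2 * B₁ 0 1) - B₂ 0 0 / (2 * B₂ 0 1)

theorem rateGap_eq (B₁ B₂ : Matrix.SpecialLinearGroup (Fin 2) ℝ) (n : ℝ) :
    rateGap B₁ B₂ = innerRate n B₁ - innerRate n B₂ := by
  unfold rateGap innerRate
  ring

/-- The covariance of the transforms of unit white noise at the points `x` and `y`; the Gaussian
parameter `z` collects the windows and the chirps of the two kernels. -/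
def noiseCov (B₁ B₂ : Matrix.SpecialLinearGroup (Fin 2) ℝ) (z : ℂ) (x y : ℝ) : ℂ :=
  lctConst B₁ * conj (lctConst B₂) * cexp (I * ((B₁ 1 1 / (2 * B₁ 0 1) * x ^ 2
    - B₂ 1 1 / (2 * B₂ 0 1) * y ^ 2 : ℝ) : ℂ)) * gaussFT z (y / B₂ 0 1 - x / B₁ 0 1)

theorem continuous_noiseCov (z : ℂ) : Continuous fun p : ℝ × ℝ => noiseCov B₁ B₂ z p.1 p.2 := by
  unfold noiseCov
  have := continuous_gaussFT z
  fun_prop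

theorem norm_noiseCov (z : ℂ) (x y : ℝ) : ‖noiseCov B₁ B₂ z x y‖
    = ‖lctConst B₁‖ * ‖lctConst B₂‖ * ‖gaussFT z (y / B₂ 0 1 - x / B₁ 0 1)‖ := by
  rw [noiseCov, norm_mul, norm_mul, norm_mul, Complex.norm_exp_I_mul_ofReal, RCLike.norm_conj,
    mul_one]

theorem integral_window_kernel_mul_conj {ε : ℝ} (hε : 0 < ε) (x y : ℝ) :
    ∫ s, (gaussWindow ε s * lctKernel B₁ x s) * conj (gaussWindow ε s * lctKernel B₂ y s)
      = noiseCov B₁ B₂ ((2 * ε : ℝ) - I * rateGap B₁ B₂) x y := by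
  rw [noiseCov, ← integral_cexp_eq_gaussFT (by simpa using hε), ← integral_const_mul]
  congr 1; ext s
  have hw : conj (gaussWindow ε s) = gaussWindow ε s := by
    rw [gaussWindow, ← Complex.exp_conj, Complex.conj_ofReal]
  rw [map_mul, hw, lctKernel_eq, lctKernel_eq, map_mul, conj_cexp_I_mul]
  calc gaussWindow ε s * (lctConst B₁ * cexp (I * ((B₁ 1 1 / (2 * B₁ 0 1) * x ^ 2
        - 1 / B₁ 0 1 * x * s + B₁ 0 0 / (2 * B₁ 0 1) * s ^ 2 : ℝ) : ℂ))) *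
      (gaussWindow ε s * (conj (lctConst B₂) * cexp (I * ((-(B₂ 1 1 / (2 * B₂ 0 1) * y ^ 2
        - 1 / B₂ 0 1 * y * s + B₂ 0 0 / (2 * B₂ 0 1) * s ^ 2) : ℝ) : ℂ))))
      = lctConst B₁ * conj (lctConst B₂) * ((gaussWindow ε s * gaussWindow ε s) *
        (cexp (I * ((B₁ 1 1 / (2 * B₁ 0 1) * x ^ 2
        - 1 / B₁ 0 1 * x * s + B₁ 0 0 / (2 * B₁ 0 1) * s ^ 2 : ℝ) : ℂ)) *
        cexp (I * ((-(B₂ 1 1 / (2 * B₂ 0 1) * y ^ 2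
        - 1 / B₂ 0 1 * y * s + B₂ 0 0 / (2 * B₂ 0 1) * s ^ 2) : ℝ) : ℂ)))) := by ring
    _ = _ := ?_
  rw [mul_assoc (lctConst B₁ * _), gaussWindow]
  simp only [← Complex.exp_add]
  congr 2
  unfold rateGap
  push_cast
  ring

variable {Ω : Type*} [MeasurableSpace Ω] {P : Measure Ω} {D : ℝ}
  {noise : Lp ℂ 2 (volume : Measure ℝ) →ₗ[ℂ] Lp ℂ 2 P}

theorem IsWhiteNoise.integral_noiseLCT (h : IsWhiteNoise P D noise) {ε : ℝ} (hε : 0 < ε)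
    (x y : ℝ) :
    ∫ ω, noiseLCT noise B₁ ε x ω * conj (noiseLCT noise B₂ ε y ω) ∂P
      = D * noiseCov B₁ B₂ ((2 * ε : ℝ) - I * rateGap B₁ B₂) x y := by
  rw [noiseLCT, noiseLCT, dif_pos hε, dif_pos hε, h.covariance, ← integral_window_kernel_mul_conj hε]
  congr 1
  refine integral_congr_ae ?_
  filter_upwards [(memLp_gaussWindow_mul_lctKernel B₁ hε x).coeFn_toLp,
    (memLp_gaussWindow_mul_lctKernel B₂ hε y).coeFn_toLp] with s h1 h2
  rw [h1, h2]

theorem IsWhiteNoise.inner_noiseLCT (h : IsWhiteNoise P D noise) {ε : ℝ} (hε : 0 < ε)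
    (x y : ℝ) :
    inner ℂ (noiseLCT noise B₂ ε y) (noiseLCT noise B₁ ε x)
      = D * noiseCov B₁ B₂ ((2 * ε : ℝ) - I * rateGap B₁ B₂) x y := by
  rw [← h.integral_noiseLCT hε, L2.inner_def]
  rfl

/-- The transform of windowed white noise is continuous in mean square, as its covariance is
continuous. -/
theorem IsWhiteNoise.continuous_noiseLCT (h : IsWhiteNoise P D noise) {ε : ℝ} (hε : 0 < ε)
    (B : Matrix.SpecialLinearGroup (Fin 2) ℝ) : Continuous (noiseLCT noise B ε) := by
  set R : ℝ → ℝ → ℂ := fun x y => D * noiseCov B B ((2 * ε : ℝ) - I * rateGap B B) x y with hR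
  have hcR : Continuous fun p : ℝ × ℝ => R p.1 p.2 := continuous_const.mul (continuous_noiseCov _)
  have hin : ∀ x y, inner ℂ (noiseLCT noise B ε y) (noiseLCT noise B ε x) = R x y :=
    fun x y => h.inner_noiseLCT hε x y
  clear_value R
  rw [continuous_iff_continuousAt]
  intro x₀
  rw [ContinuousAt, tendsto_iff_norm_sub_tendsto_zero]
  have hsq : ∀ x, ‖noiseLCT noise B ε x - noiseLCT noise B ε x₀‖
      = √((R x x - R x₀ x - R x x₀ + R x₀ x₀).re) := by
    intro x
    rw [← Real.sqrt_sq (norm_nonneg _), ← inner_self_eq_norm_sq (𝕜 := ℂ), inner_sub_left,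
      inner_sub_right, inner_sub_right, hin, hin, hin, hin]
    rw [sub_add]
    rfl
  simp_rw [hsq]
  have hc : Continuous fun x => √((R x x - R x₀ x - R x x₀ + R x₀ x₀).re) := by
    have h1 : Continuous fun x => R x x := hcR.comp (f := fun x : ℝ => (x, x)) (by fun_prop)
    have h2 : Continuous fun x => R x₀ x := hcR.comp (f := fun x : ℝ => (x₀, x)) (by fun_prop)
    have h3 : Continuous fun x => R x x₀ := hcR.comp (f := fun x : ℝ => (x, x₀)) (by fun_prop)
    fun_prop
  have h0 : √((R x₀ x₀ - R x₀ x₀ - R x₀ x₀ + R x₀ x₀).re) = 0 := by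
    rw [sub_self, zero_sub, neg_add_cancel, Complex.zero_re, Real.sqrt_zero]
  have hlim := hc.tendsto x₀
  rwa [h0] at hlim

theorem IsWhiteNoise.norm_noiseLCT (h : IsWhiteNoise P D noise) {ε : ℝ} (hε : 0 < ε)
    (B : Matrix.SpecialLinearGroup (Fin 2) ℝ) (x : ℝ) :
    ‖noiseLCT noise B ε x‖ = ‖noiseLCT noise B ε 0‖ := by
  have hx : ∀ x, ‖noiseLCT noise B ε x‖ ^ 2
      = ‖(D : ℂ) * (‖lctConst B‖ ^ 2 * gaussFT ((2 * ε : ℝ) - I * rateGap B B) 0)‖ := by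
    intro x
    have h1 := inner_self_eq_norm_sq_to_K (𝕜 := ℂ) (noiseLCT noise B ε x)
    rw [h.inner_noiseLCT hε, noiseCov, sub_self, sub_self, Complex.mul_conj'] at h1
    have h2 := congrArg norm h1
    simpa using h2.symm
  have := (hx x).trans (hx 0).symm
  exact (pow_left_inj₀ (norm_nonneg _) (norm_nonneg _) two_ne_zero).1 this

theorem continuous_lpSMul {f g : ℝ → Lp ℂ 2 P} (hf : Continuous f) (hg : Continuous g) :
    Continuous fun τ => (f τ • g τ : Lp ℂ 1 P) := by
  rw [continuous_iff_continuousAt]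
  intro τ₀
  rw [ContinuousAt, tendsto_iff_norm_sub_tendsto_zero]
  have hlim : Tendsto (fun τ => ‖f τ - f τ₀‖ * ‖g τ‖ + ‖f τ₀‖ * ‖g τ - g τ₀‖) (𝓝 τ₀) (𝓝 0) := by
    have : Continuous fun τ => ‖f τ - f τ₀‖ * ‖g τ‖ + ‖f τ₀‖ * ‖g τ - g τ₀‖ := by fun_prop
    simpa using this.tendsto τ₀
  refine squeeze_zero (fun _ => norm_nonneg _) (fun τ => ?_) hlim
  have : (f τ • g τ : Lp ℂ 1 P) - (f τ₀ • g τ₀ : Lp ℂ 1 P)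
      = ((f τ - f τ₀) • g τ : Lp ℂ 1 P) + (f τ₀ • (g τ - g τ₀) : Lp ℂ 1 P) := by
    rw [sub_eq_add_neg (f τ), sub_eq_add_neg (g τ), Lp.smul_add, Lp.add_smul, Lp.neg_smul,
      Lp.smul_neg]
    abel
  rw [this]
  exact (norm_add_le _ _).trans (add_le_add (Lp.norm_smul_le _ _) (Lp.norm_smul_le _ _))

theorem norm_lpStar (f : Lp ℂ 2 P) : ‖star f‖ = ‖f‖ := by
  rw [Lp.norm_def, Lp.norm_def, eLpNorm_congr_ae (Lp.coeFn_star f), eLpNorm_star]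

theorem continuous_lpStar : Continuous fun f : Lp ℂ 2 P => star f := by
  refine (Isometry.of_dist_eq fun f g => ?_).continuous
  have h : star f - star g = star (f - g) := by
    refine Lp.ext ?_
    filter_upwards [Lp.coeFn_sub (star f) (star g), Lp.coeFn_star f, Lp.coeFn_star g,
      Lp.coeFn_star (f - g), Lp.coeFn_sub f g] with ω h1 h2 h3 h4 h5
    rw [h1, h4, Pi.sub_apply, h2, h3, Pi.star_apply, Pi.star_apply, Pi.star_apply, h5, Pi.sub_apply,
      star_sub]
  rw [dist_eq_norm, dist_eq_norm, h, norm_lpStar]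

/-- The integral over the lag that defines the distribution of the noise converges in `L¹(P)`, so
the expectation may be taken under the integral sign. -/
theorem IsWhiteNoise.integral_noiseGLWD (h : IsWhiteNoise P D noise) {ε : ℝ} (hε : 0 < ε)
    (hA : 1 / A₁ 0 1 + 1 / A₂ 0 1 ≠ 0) (t : ℝ) {φ : ℝ → ℂ} (hφ : IsTestFunction φ) :
    ∫ ω, noiseGLWD noise B₁ B₂ A₁ A₂ ε t φ ω ∂P
      = ∫ τ, (D * noiseCov B₁ B₂ ((2 * ε : ℝ) - I * rateGap B₁ B₂) (t + τ / 2) (t - τ / 2)) *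
          kernelPairing A₁ A₂ φ t τ := by
  set X : ℝ → Lp ℂ 1 P := fun τ =>
    (noiseLCT noise B₁ ε (t + τ / 2) • star (noiseLCT noise B₂ ε (t - τ / 2)) : Lp ℂ 1 P) with hX
  have hN₁ := h.continuous_noiseLCT hε B₁
  have hN₂ := h.continuous_noiseLCT hε B₂
  have hXc : Continuous X := continuous_lpSMul (by fun_prop)
    (continuous_lpStar.comp (hN₂.comp (by fun_prop)))
  have hXb : ∀ τ, ‖X τ‖ ≤ ‖noiseLCT noise B₁ ε 0‖ * ‖noiseLCT noise B₂ ε 0‖ := by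
    intro τ
    refine (Lp.norm_smul_le _ _).trans (le_of_eq ?_)
    rw [norm_lpStar, h.norm_noiseLCT hε, h.norm_noiseLCT hε B₂ (t - τ / 2)]
  have hint : Integrable fun τ => kernelPairing A₁ A₂ φ t τ • X τ := by
    refine ((integrable_kernelPairing hφ hA t).norm.mul_const
      (‖noiseLCT noise B₁ ε 0‖ * ‖noiseLCT noise B₂ ε 0‖)).mono'
      ((continuous_kernelPairing hφ t).smul hXc).aestronglyMeasurable
      (Eventually.of_forall fun τ => ?_)
    rw [norm_smul]
    gcongr
    exact hXb τ
  have hL : ∀ f : Lp ℂ 1 P, ∫ ω, f ω ∂P = L1.integralCLM' ℂ f := fun f => by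
    rw [← L1.integral_eq_integral, L1.integral_eq' ℂ]
  calc _ = ∫ ω, (∫ τ, kernelPairing A₁ A₂ φ t τ • X τ : Lp ℂ 1 P) ω ∂P := rfl
    _ = ∫ τ, L1.integralCLM' ℂ (kernelPairing A₁ A₂ φ t τ • X τ) := by
      rw [hL, ContinuousLinearMap.integral_comp_comm _ hint]
    _ = _ := by
      congr 1; ext τ
      rw [map_smul, ← hL, ← h.integral_noiseLCT hε, smul_eq_mul, mul_comm]
      congr 1
      refine integral_congr_ae ?_
      filter_upwards [Lp.coeFn_lpSMul (r := 1) (noiseLCT noise B₁ ε (t + τ / 2))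
        (star (noiseLCT noise B₂ ε (t - τ / 2))),
        Lp.coeFn_star (noiseLCT noise B₂ ε (t - τ / 2))] with ω h1 h2
      rw [hX, h1, Pi.smul_apply', h2, smul_eq_mul]
      rfl

end

section
variable {B₁ B₂ A₁ A₂ : Matrix.SpecialLinearGroup (Fin 2) ℝ}
  {Ω : Type*} [MeasurableSpace Ω] {P : Measure Ω} {D : ℝ}
  {noise : Lp ℂ 2 (volume : Measure ℝ) →ₗ[ℂ] Lp ℂ 2 P}

theorem IsWhiteNoise.hasNoiseMean_of_tendsto (h : IsWhiteNoise P D noise)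
    (hA : 1 / A₁ 0 1 + 1 / A₂ 0 1 ≠ 0) {E : ℝ → ℝ → ℂ} (hE : ∀ t, Continuous (E t))
    (hlim : ∀ t φ, IsTestFunction φ → Tendsto (fun ε : ℝ => ∫ τ,
      noiseCov B₁ B₂ ((2 * ε : ℝ) - I * rateGap B₁ B₂) (t + τ / 2) (t - τ / 2) *
        kernelPairing A₁ A₂ φ t τ) (𝓝[>] 0) (𝓝 (∫ u, φ u * E t u))) :
    HasNoiseMean noise B₁ B₂ A₁ A₂ (fun t u => D * E t u) := by
  refine fun t => ⟨continuous_const.mul (hE t), fun φ hφ => ?_⟩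
  have e : ∫ u, D * E t u * φ u = D * ∫ u, φ u * E t u := by
    rw [← integral_const_mul]
    congr 1; ext u; ring
  rw [e]
  refine ((hlim t φ hφ).const_mul (D : ℂ)).congr' ?_
  filter_upwards [self_mem_nhdsWithin] with ε hε
  rw [h.integral_noiseGLWD hε hA t hφ, ← integral_const_mul]
  congr 1; ext τ; ring

/-- The phase in `τ` of the integrand of the expected distribution of white noise, up to its
dependence on `u`, if the chirp rates of the two kernels differ. -/
def noisePhase (B₁ B₂ A₁ A₂ : Matrix.SpecialLinearGroup (Fin 2) ℝ) (t τ : ℝ) : ℝ :=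
  B₁ 1 1 / (2 * B₁ 0 1) * (t + τ / 2) ^ 2 - B₂ 1 1 / (2 * B₂ 0 1) * (t - τ / 2) ^ 2
    - ((t - τ / 2) / B₂ 0 1 - (t + τ / 2) / B₁ 0 1) ^ 2 / (4 * rateGap B₁ B₂)
    + lagPhase A₁ A₂ t τ

/-- The coefficient of `τ²` in `noisePhase`. -/
def noiseCurvature (B₁ B₂ A₁ A₂ : Matrix.SpecialLinearGroup (Fin 2) ℝ) : ℝ :=
  B₁ 1 1 / (8 * B₁ 0 1) - B₂ 1 1 / (8 * B₂ 0 1)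
    + (A₁ 0 0 * A₂ 0 1 - A₂ 0 0 * A₁ 0 1) / (8 * A₁ 0 1 * A₂ 0 1)
    - (1 / B₁ 0 1 + 1 / B₂ 0 1) ^ 2 / (16 * rateGap B₁ B₂)

/-- The coefficient of `t τ` in `noisePhase`. -/
def noiseSlope (B₁ B₂ A₁ A₂ : Matrix.SpecialLinearGroup (Fin 2) ℝ) : ℝ :=
  B₁ 1 1 / (2 * B₁ 0 1) + B₂ 1 1 / (2 * B₂ 0 1) + A₁ 0 0 / (2 * A₁ 0 1) + A₂ 0 0 / (2 * A₂ 0 1)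
    + (1 / B₂ 0 1 ^ 2 - 1 / B₁ 0 1 ^ 2) / (4 * rateGap B₁ B₂)

theorem noisePhase_eq (hB₁ : B₁ 0 1 ≠ 0) (hB₂ : B₂ 0 1 ≠ 0) (hA₁ : A₁ 0 1 ≠ 0) (hA₂ : A₂ 0 1 ≠ 0)
    (hp : rateGap B₁ B₂ ≠ 0) (t τ : ℝ) :
    noisePhase B₁ B₂ A₁ A₂ t τ = noisePhase B₁ B₂ A₁ A₂ t 0 +
      (noiseCurvature B₁ B₂ A₁ A₂ * τ ^ 2 + noiseSlope B₁ B₂ A₁ A₂ * t * τ) := by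
  unfold noisePhase noiseCurvature noiseSlope lagPhase
  generalize rateGap B₁ B₂ = p at *
  field_simp
  ring

theorem noiseCov_mul_lagPhase (hB₁ : B₁ 0 1 ≠ 0) (hB₂ : B₂ 0 1 ≠ 0) (hA₁ : A₁ 0 1 ≠ 0)
    (hA₂ : A₂ 0 1 ≠ 0) (hp : rateGap B₁ B₂ ≠ 0) (t τ : ℝ) :
    noiseCov B₁ B₂ (-(I * rateGap B₁ B₂)) (t + τ / 2) (t - τ / 2) *
        cexp (I * (lagPhase A₁ A₂ t τ : ℂ))
      = lctConst B₁ * conj (lctConst B₂) * (Real.pi / (-(I * rateGap B₁ B₂))) ^ (1 / 2 : ℂ) *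
        cexp (I * (noisePhase B₁ B₂ A₁ A₂ t 0 : ℂ)) *
        cexp (I * ((noiseCurvature B₁ B₂ A₁ A₂ * τ ^ 2 + noiseSlope B₁ B₂ A₁ A₂ * t * τ : ℝ) : ℂ))
      := by
  have hP : cexp (I * (noisePhase B₁ B₂ A₁ A₂ t τ : ℂ)) = _ :=
    congrArg (fun x : ℝ => cexp (I * (x : ℂ))) (noisePhase_eq hB₁ hB₂ hA₁ hA₂ hp t τ)
  rw [Complex.ofReal_add, mul_add, Complex.exp_add] at hP
  rw [mul_assoc _ (cexp _) (cexp _), ← hP]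
  have hQ : cexp (I * (noisePhase B₁ B₂ A₁ A₂ t τ : ℂ))
      = cexp (I * ((B₁ 1 1 / (2 * B₁ 0 1) * (t + τ / 2) ^ 2
          - B₂ 1 1 / (2 * B₂ 0 1) * (t - τ / 2) ^ 2 : ℝ) : ℂ)) *
        cexp (I * ((-(((t - τ / 2) / B₂ 0 1 - (t + τ / 2) / B₁ 0 1) ^ 2
          / (4 * rateGap B₁ B₂)) : ℝ) : ℂ)) *
        cexp (I * (lagPhase A₁ A₂ t τ : ℂ)) := by
    simp only [← Complex.exp_add, ← mul_add, ← Complex.ofReal_add]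
    congr 3
  rw [hQ, noiseCov, gaussFT_neg_I_mul]
  ring

/-- If the chirp rates of the two kernels differ, then the covariance of the transforms stays
bounded and tends to a chirp. -/
theorem IsWhiteNoise.exists_hasNoiseMean_of_rateGap_ne_zero (h : IsWhiteNoise P D noise)
    (hB₁ : B₁ 0 1 ≠ 0) (hB₂ : B₂ 0 1 ≠ 0) (hA₁ : A₁ 0 1 ≠ 0) (hA₂ : A₂ 0 1 ≠ 0)
    (hA : 1 / A₁ 0 1 + 1 / A₂ 0 1 ≠ 0) (hp : rateGap B₁ B₂ ≠ 0)
    (hκ : noiseCurvature B₁ B₂ A₁ A₂ ≠ 0) :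
    ∃ E, HasNoiseMean noise B₁ B₂ A₁ A₂ E ∧ ∀ t u, ‖E t u‖ =
      |D| * (‖lctConst B₁‖ * ‖lctConst B₂‖ * (‖lctConst A₁‖ * ‖lctConst A₂‖)) *
        (√(Real.pi / |rateGap B₁ B₂|) * √(Real.pi / |noiseCurvature B₁ B₂ A₁ A₂|)) := by
  set Γ : ℝ → ℂ := fun t => lctConst B₁ * conj (lctConst B₂) *
    (Real.pi / (-(I * rateGap B₁ B₂))) ^ (1 / 2 : ℂ) *
    cexp (I * (noisePhase B₁ B₂ A₁ A₂ t 0 : ℂ)) with hΓ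
  refine ⟨_, h.hasNoiseMean_of_tendsto hA (E := fun t u => Γ t *
    (lctConst A₁ * conj (lctConst A₂)) * residualChirp A₁ A₂ t u *
    gaussFT (-(I * noiseCurvature B₁ B₂ A₁ A₂)) (noiseSlope B₁ B₂ A₁ A₂ * t
      - (1 / A₁ 0 1 + 1 / A₂ 0 1) / 2 * u)) ?_ ?_, ?_⟩
  · intro t
    have h1 := (contDiff_residualChirp A₁ A₂ t).continuous
    have h2 := continuous_gaussFT (-(I * noiseCurvature B₁ B₂ A₁ A₂))
    fun_prop
  · intro t φ hφ
    rw [← integral_mul_kernelPairing_quadratic hφ hA t hκ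
      (noiseCov_mul_lagPhase hB₁ hB₂ hA₁ hA₂ hp t)]
    refine tendsto_integral_filter_of_dominated_convergence
      (fun τ => (‖lctConst B₁‖ * ‖lctConst B₂‖ * √(Real.pi / |rateGap B₁ B₂|)) *
        ‖kernelPairing A₁ A₂ φ t τ‖) ?_ ?_
      ((integrable_kernelPairing hφ hA t).norm.const_mul _) ?_
    · refine Eventually.of_forall fun ε => Continuous.aestronglyMeasurable ?_
      exact ((continuous_noiseCov _).comp (f := fun τ : ℝ => (t + τ / 2, t - τ / 2))
        (by fun_prop)).mul (continuous_kernelPairing hφ t)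
    · filter_upwards [self_mem_nhdsWithin] with ε hε
      have hε : 0 < ε := hε
      refine Eventually.of_forall fun τ => ?_
      rw [norm_mul, norm_noiseCov]
      gcongr
      refine (norm_gaussFT_le (by simpa using hε.le) _).trans ?_
      have h1 : |rateGap B₁ B₂| ≤ ‖((2 * ε : ℝ) : ℂ) - I * rateGap B₁ B₂‖ := by
        have := Complex.abs_im_le_norm (((2 * ε : ℝ) : ℂ) - I * rateGap B₁ B₂)
        simpa using this
      have := abs_pos.2 hp
      have := Real.pi_pos
      gcongr
    · refine Eventually.of_forall fun τ => Tendsto.mul_const _ ?_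
      refine Tendsto.const_mul _ (tendsto_gaussFT ?_ tendsto_const_nhds (by simp [hp]) ?_)
      · have : Continuous fun e : ℝ => ((2 * e : ℝ) : ℂ) - I * rateGap B₁ B₂ := by fun_prop
        have h := (this.tendsto 0).mono_left (nhdsWithin_le_nhds (s := Set.Ioi 0))
        rwa [mul_zero, Complex.ofReal_zero, zero_sub] at h
      · filter_upwards [self_mem_nhdsWithin] with ε hε
        have hε : 0 < ε := hε
        have : 0 < (((2 * ε : ℝ) : ℂ) - I * rateGap B₁ B₂).re := by simpa
        exact ⟨this.le, fun h0 => by rw [h0, Complex.zero_re] at this; exact this.false⟩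
  · intro t u
    have hpi : ‖(Real.pi : ℂ) / (-(I * rateGap B₁ B₂))‖ = Real.pi / |rateGap B₁ B₂| := by
      simp [abs_of_pos Real.pi_pos]
    rw [norm_mul, norm_mul, norm_mul, norm_mul, norm_mul, norm_gaussFT_neg_I_mul,
      norm_residualChirp, norm_mul, norm_mul, norm_mul, Complex.norm_exp_I_mul_ofReal,
      norm_cpow_half, hpi, RCLike.norm_conj, RCLike.norm_conj, Complex.norm_real, Real.norm_eq_abs]
    ring

/-- If the chirp rates of the two kernels agree, then the covariance of the transforms concentrates
at a single lag. -/
theorem IsWhiteNoise.exists_hasNoiseMean_of_rateGap_eq_zero (h : IsWhiteNoise P D noise)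
    (hB₁ : B₁ 0 1 ≠ 0) (hB₂ : B₂ 0 1 ≠ 0) (hA : 1 / A₁ 0 1 + 1 / A₂ 0 1 ≠ 0)
    (hp : rateGap B₁ B₂ = 0) (hs : 1 / B₁ 0 1 + 1 / B₂ 0 1 ≠ 0) :
    ∃ E, HasNoiseMean noise B₁ B₂ A₁ A₂ E ∧ ∀ t u, ‖E t u‖ =
      |D| * (‖lctConst B₁‖ * ‖lctConst B₂‖ * (‖lctConst A₁‖ * ‖lctConst A₂‖)) *
        (4 * Real.pi / |1 / B₁ 0 1 + 1 / B₂ 0 1|) := by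
  set s : ℝ := 1 / B₁ 0 1 + 1 / B₂ 0 1 with hs_def
  set a : ℝ := s ^ 2 / 32 with ha_def
  have ha : 0 < a := by positivity
  -- the lag at which the centre `y/b̄₂ - x/b̄₁` of the Gaussian vanishes
  set τ₀ : ℝ → ℝ := fun t => 2 * t * (1 / B₂ 0 1 - 1 / B₁ 0 1) / s with hτ₀
  set Q : ℝ → ℝ → ℂ := fun t τ => lctConst B₁ * conj (lctConst B₂) *
    cexp (I * ((B₁ 1 1 / (2 * B₁ 0 1) * (t + τ / 2) ^ 2
      - B₂ 1 1 / (2 * B₂ 0 1) * (t - τ / 2) ^ 2 : ℝ) : ℂ)) * ((√(Real.pi / 2) : ℝ) : ℂ) with hQ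
  have hQn : ∀ t τ, ‖Q t τ‖ = ‖lctConst B₁‖ * ‖lctConst B₂‖ * √(Real.pi / 2) := by
    intro t τ
    rw [hQ, norm_mul, norm_mul, norm_mul, Complex.norm_exp_I_mul_ofReal, RCLike.norm_conj,
      mul_one, Complex.norm_real, Real.norm_of_nonneg (Real.sqrt_nonneg _)]
  have hQc : ∀ t, Continuous (Q t) := by
    intro t
    rw [hQ]
    fun_prop
  clear_value Q
  refine ⟨_, h.hasNoiseMean_of_tendsto hA (E := fun t u => (√(Real.pi / a) : ℝ) * Q t (τ₀ t) *
    (lctKernel A₁ u (t + τ₀ t / 2) * conj (lctKernel A₂ u (t - τ₀ t / 2)))) ?_ ?_, ?_⟩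
  · intro t
    have h1 := (contDiff_lctKernel A₁ (t + τ₀ t / 2)).continuous
    have h2 := (contDiff_lctKernel A₂ (t - τ₀ t / 2)).continuous
    exact continuous_const.mul (h1.mul (Complex.continuous_conj.comp h2))
  · intro t φ hφ
    have hc : Continuous fun τ => Q t τ * kernelPairing A₁ A₂ φ t τ :=
      (hQc t).mul (continuous_kernelPairing hφ t)
    have key := tendsto_integral_concentrating ha (τ₀ t)
      (‖lctConst B₁‖ * ‖lctConst B₂‖ * √(Real.pi / 2) *
        (‖lctConst A₁‖ * ‖lctConst A₂‖ * ∫ u, ‖φ u‖))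
      (r := fun ε τ => Q t τ * kernelPairing A₁ A₂ φ t τ)
      (r₀ := Q t (τ₀ t) * kernelPairing A₁ A₂ φ t (τ₀ t))
      (Eventually.of_forall fun ε => ⟨hc, fun τ => by
        rw [norm_mul, hQn]
        gcongr
        exact norm_kernelPairing_le _ _⟩)
      ((hc.tendsto (τ₀ t)).comp tendsto_snd)
    have e : ∫ u, φ u * ((√(Real.pi / a) : ℝ) * Q t (τ₀ t) *
        (lctKernel A₁ u (t + τ₀ t / 2) * conj (lctKernel A₂ u (t - τ₀ t / 2))))
        = (√(Real.pi / a) : ℝ) * (Q t (τ₀ t) * kernelPairing A₁ A₂ φ t (τ₀ t)) := by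
      rw [kernelPairing, ← mul_assoc, ← integral_const_mul]
      congr 1; ext u; ring
    rw [e]
    refine key.congr' ?_
    filter_upwards [self_mem_nhdsWithin] with ε hε
    have hε : 0 < ε := hε
    congr 1; ext τ
    have h1 : -(((t - τ / 2) / B₂ 0 1 - (t + τ / 2) / B₁ 0 1) ^ 2) / (4 * (2 * ε))
        = -a * (τ - τ₀ t) ^ 2 / ε := by
      have : (t - τ / 2) / B₂ 0 1 - (t + τ / 2) / B₁ 0 1 = -(s / 2) * (τ - τ₀ t) := by
        have : s * τ₀ t = 2 * t * (1 / B₂ 0 1 - 1 / B₁ 0 1) := by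
          rw [hτ₀]; field_simp
        rw [mul_sub, neg_mul, neg_mul, div_mul_eq_mul_div _ _ (τ₀ t), this, hs_def]
        ring
      rw [this, ha_def]
      field_simp
      ring
    have h2 : √Real.pi * (√(2 * ε))⁻¹ = (√ε)⁻¹ * √(Real.pi / 2) := by
      rw [Real.sqrt_mul two_pos.le, Real.sqrt_div Real.pi_pos.le]
      field_simp
    rw [noiseCov, hp, Complex.ofReal_zero, mul_zero, sub_zero, gaussFT_ofReal (by positivity), h1,
      ← mul_assoc, ← mul_assoc √Real.pi, h2, hQ]
    push_cast
    ring
  · intro t u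
    have hconst : √(Real.pi / a) * √(Real.pi / 2) = 4 * Real.pi / |s| := by
      rw [← Real.sqrt_mul (by positivity), ha_def]
      have : Real.pi / (s ^ 2 / 32) * (Real.pi / 2) = (4 * Real.pi / |s|) ^ 2 := by
        rw [div_pow, sq_abs]
        field_simp
        ring
      rw [this, Real.sqrt_sq (by have := Real.pi_pos; positivity)]
    rw [← hconst, norm_mul, norm_mul, norm_mul, norm_mul, hQn, RCLike.norm_conj, norm_lctKernel,
      norm_lctKernel, Complex.norm_real, Complex.norm_real, Real.norm_eq_abs,
      Real.norm_of_nonneg (Real.sqrt_nonneg _)]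
    ring

/-- If `l = 0`, then completing the square in the noise phase is governed by `h₁ + h₂`. -/
theorem noiseCurvature_mul_rateGap (hB₁ : B₁ 0 1 ≠ 0) (hB₂ : B₂ 0 1 ≠ 0) {n : ℝ}
    (h₁ : innerRate n B₁ ≠ 0) (h₂ : innerRate n B₂ ≠ 0) (hl : chirpL n B₁ B₂ A₁ A₂ = 0)
    (hp : rateGap B₁ B₂ ≠ 0) :
    noiseCurvature B₁ B₂ A₁ A₂ * rateGap B₁ B₂
      = -((chirpH n B₁ + chirpH n B₂) ^ 2 * (innerRate n B₁ * innerRate n B₂) / 4) := by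
  have hk : noiseCurvature B₁ B₂ A₁ A₂ = chirpH n B₁ / (8 * B₁ 0 1) - chirpH n B₂ / (8 * B₂ 0 1)
      - (1 / B₁ 0 1 + 1 / B₂ 0 1) ^ 2 / (16 * rateGap B₁ B₂) := by
    rw [← sub_zero (noiseCurvature B₁ B₂ A₁ A₂), ← hl]
    unfold noiseCurvature chirpL
    ring
  rw [hk, chirpH, chirpH, chirpInv_eq hB₁, chirpInv_eq hB₂]
  rw [sub_mul _ _ (rateGap B₁ B₂), div_mul_eq_mul_div _ _ (rateGap B₁ B₂),
    mul_div_mul_right _ _ hp, rateGap_eq B₁ B₂ n]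
  field_simp
  ring

/-- For `l = 0` the expected distribution of the noise has constant modulus, and the two cases
lead to the same constant. -/
theorem IsWhiteNoise.exists_hasNoiseMean (h : IsWhiteNoise P D noise)
    (hB₁ : B₁ 0 1 ≠ 0) (hB₂ : B₂ 0 1 ≠ 0) (hA₁ : A₁ 0 1 ≠ 0) (hA₂ : A₂ 0 1 ≠ 0)
    (hA : 1 / A₁ 0 1 + 1 / A₂ 0 1 ≠ 0) {n : ℝ} (h₁ : innerRate n B₁ ≠ 0)
    (h₂ : innerRate n B₂ ≠ 0) (hh : chirpH n B₁ + chirpH n B₂ ≠ 0)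
    (hl : chirpL n B₁ B₂ A₁ A₂ = 0) :
    ∃ E, HasNoiseMean noise B₁ B₂ A₁ A₂ E ∧ ∀ t u, ‖E t u‖ =
      |D| * (‖lctConst B₁‖ * ‖lctConst B₂‖ * (‖lctConst A₁‖ * ‖lctConst A₂‖)) *
        (√(Real.pi / |innerRate n B₁|) * √(Real.pi / |innerRate n B₂|) *
          (2 / |chirpH n B₁ + chirpH n B₂|)) := by
  have hpi := Real.pi_pos
  have h₁' := abs_pos.2 h₁
  have h₂' := abs_pos.2 h₂
  have hh' := abs_pos.2 hh
  by_cases hp : rateGap B₁ B₂ = 0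
  · have hq : innerRate n B₁ = innerRate n B₂ := by
      rw [rateGap_eq B₁ B₂ n, sub_eq_zero] at hp
      exact hp
    have hs : 1 / B₁ 0 1 + 1 / B₂ 0 1 = 2 * innerRate n B₂ * (chirpH n B₁ + chirpH n B₂) := by
      rw [chirpH, chirpH, chirpInv_eq hB₁, chirpInv_eq hB₂, hq]
      field_simp
    obtain ⟨E, hE, hn⟩ := h.exists_hasNoiseMean_of_rateGap_eq_zero hB₁ hB₂ hA hp
      (by rw [hs]; exact mul_ne_zero (mul_ne_zero two_ne_zero h₂) hh)
    refine ⟨E, hE, fun t u => ?_⟩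
    rw [hn, hs, hq, Real.mul_self_sqrt (by positivity), abs_mul, abs_mul, abs_two]
    congr 1
    field_simp
    ring
  · have hk := noiseCurvature_mul_rateGap hB₁ hB₂ h₁ h₂ hl hp
    have hκ : noiseCurvature B₁ B₂ A₁ A₂ ≠ 0 := by
      intro h0
      rw [h0, zero_mul, eq_comm, neg_eq_zero] at hk
      have : (chirpH n B₁ + chirpH n B₂) ^ 2 * (innerRate n B₁ * innerRate n B₂) / 4 ≠ 0 := by
        positivity
      exact this hk
    obtain ⟨E, hE, hn⟩ := h.exists_hasNoiseMean_of_rateGap_ne_zero hB₁ hB₂ hA₁ hA₂ hA hp hκ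
    refine ⟨E, hE, fun t u => ?_⟩
    rw [hn]
    congr 1
    have hk' := congrArg abs hk
    rw [abs_neg, abs_div, abs_mul, abs_mul, abs_mul, abs_pow] at hk'
    have hp' := abs_pos.2 hp
    have hκ' := abs_pos.2 hκ
    have h4 : |(4 : ℝ)| = 4 := by norm_num
    rw [h4] at hk'
    rw [← Real.sqrt_mul (by positivity), ← Real.sqrt_mul (by positivity),
      ← Real.sqrt_sq (by positivity : (0 : ℝ) ≤ 2 / |chirpH n B₁ + chirpH n B₂|),
      ← Real.sqrt_mul (by positivity)]
    congr 1
    have e1 : Real.pi / |rateGap B₁ B₂| * (Real.pi / |noiseCurvature B₁ B₂ A₁ A₂|)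
        = Real.pi ^ 2 / (|noiseCurvature B₁ B₂ A₁ A₂| * |rateGap B₁ B₂|) := by
      field_simp
    rw [e1, hk']
    field_simp
    ring

end

/-! ### Means over lines -/

/-- A line is a bi-Lipschitz image of `ℝ`: it has dimension one, and its intersection with a large
ball has positive and finite length, so the average of a constant is not a junk value. -/
theorem hasMeanOver_line (α β e : ℝ) :
    HasMeanOver {z : EuclideanSpace ℝ (Fin 2) | z 1 = α * z 0 + β} (fun _ => e) e := by
  set v : EuclideanSpace ℝ (Fin 2) := !₂[1, α] with hv
  set w : EuclideanSpace ℝ (Fin 2) := !₂[0, β] with hw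
  set g : ℝ → EuclideanSpace ℝ (Fin 2) := fun t => t • v + w with hg
  have hv0 : v ≠ 0 := by
    intro h
    have := congrFun (congrArg WithLp.ofLp h) 0
    simp [hv] at this
  have hvn : 0 < ‖v‖ := norm_pos_iff.2 hv0
  have hS : {z : EuclideanSpace ℝ (Fin 2) | z 1 = α * z 0 + β} = Set.range g := by
    ext z
    constructor
    · intro hz
      have hz : z 1 = α * z 0 + β := hz
      refine ⟨z 0, ?_⟩
      ext i
      fin_cases i
      · simp [hg, hv, hw]
      · simp [hg, hv, hw, hz, mul_comm]
    · rintro ⟨t, rfl⟩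
      change (g t) 1 = α * (g t) 0 + β
      simp [hg, hv, hw, mul_comm]
  have hd : ∀ s t, dist (g s) (g t) = ‖v‖ * dist s t := by
    intro s t
    rw [dist_eq_norm, dist_eq_norm, hg]
    simp only [add_sub_add_right_eq_sub, ← sub_smul, norm_smul]
    rw [mul_comm]
  have hLip : LipschitzWith ‖v‖₊ g := LipschitzWith.of_dist_le_mul fun s t => (hd s t).le
  have hAnti : AntilipschitzWith ‖v‖₊⁻¹ g := AntilipschitzWith.of_le_mul_dist fun s t => by
    rw [hd, NNReal.coe_inv, coe_nnnorm, inv_mul_cancel_left₀ hvn.ne']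
  have hdim : dimH (Set.range g) = 1 := by
    refine le_antisymm (hLip.dimH_range_le.trans Real.dimH_univ.le) ?_
    rw [← Real.dimH_univ, ← Set.image_univ]
    exact hAnti.le_dimH_image _
  rw [hS, HasMeanOver, hdim, ENNReal.toReal_one]
  refine tendsto_const_nhds.congr' ?_
  filter_upwards [eventually_gt_atTop ‖w‖] with r hr
  have hT : Set.range g ∩ Metric.ball 0 r = g '' (g ⁻¹' Metric.ball 0 r) := by
    rw [Set.image_preimage_eq_range_inter]
  have hopen : IsOpen (g ⁻¹' Metric.ball 0 r) := Metric.isOpen_ball.preimage hLip.continuous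
  have hpos : μH[1] (g ⁻¹' Metric.ball 0 r) ≠ 0 := by
    rw [hausdorffMeasure_real]
    refine (hopen.measure_pos volume ⟨0, ?_⟩).ne'
    simpa [hg] using hr
  have hfin : μH[1] (g ⁻¹' Metric.ball 0 r) ≠ ⊤ := by
    rw [hausdorffMeasure_real]
    exact (hAnti.isBounded_preimage Metric.isBounded_ball).measure_lt_top.ne
  refine (setAverage_const (fun h0 => hpos ?_) ?_ e).symm
  · rw [hT] at h0
    have := hAnti.le_hausdorffMeasure_image zero_le_one (g ⁻¹' Metric.ball 0 r)
    rw [h0, mul_zero] at this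
    exact nonpos_iff_eq_zero.1 this
  · rw [hT]
    refine ne_top_of_le_ne_top ?_ (hLip.hausdorffMeasure_image_le zero_le_one _)
    exact ENNReal.mul_ne_top (by simp) hfin

/-! ### The signal-to-noise ratio -/

section
variable {B₁ B₂ A₁ A₂ : Matrix.SpecialLinearGroup (Fin 2) ℝ}
  {Ω : Type*} [MeasurableSpace Ω] {P : Measure Ω}
  {noise : Lp ℂ 2 (volume : Measure ℝ) →ₗ[ℂ] Lp ℂ 2 P}

theorem HasOSNR.eq_zero_of_forall_hasImpulse_zero {f : ℝ → ℂ} {v : ℝ}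
    (h : HasOSNR B₁ B₂ A₁ A₂ f noise v)
    (hW : ∀ t, ∃ W, HasGLWD B₁ B₂ A₁ A₂ f t W ∧ ∀ u, HasImpulse W u 0) : v = 0 := by
  obtain ⟨W, c, E, p, M, hGW, hc, ⟨⟨z, hz⟩, -⟩, -, -, -, rfl⟩ := h
  have hc0 : c z.1 z.2 = 0 := by
    obtain ⟨W', hW', hi⟩ := hW z.1
    refine (hc z.1 z.2).unique fun φ hφ => (hi z.2 φ hφ).congr' ?_
    filter_upwards [self_mem_nhdsWithin] with r hr
    exact hW'.unique (hGW z.1) (hφ.comp_scale z.2 (ne_of_gt hr))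
  have hz : ‖c z.1 z.2‖ = p := hz
  rw [← hz, hc0, norm_zero, zero_div]

end

end

theorem mainTheorem2 {Ω : Type*} [MeasurableSpace Ω] (P : Measure Ω) [IsProbabilityMeasure P]
    (B₁ B₂ A₁ A₂ : Matrix.SpecialLinearGroup (Fin 2) ℝ)
    (hB₁ : B₁ 0 1 ≠ 0) (hB₂ : B₂ 0 1 ≠ 0) (hA₁ : A₁ 0 1 ≠ 0) (hA₂ : A₂ 0 1 ≠ 0)
    (hA : 1 / A₁ 0 1 + 1 / A₂ 0 1 ≠ 0)
    (m n : ℝ)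
    (hh : chirpInv n B₁ ≠ 0 → chirpInv n B₂ ≠ 0 → chirpH n B₁ + chirpH n B₂ ≠ 0)
    (D : ℝ) (hD : 0 < D)
    (noise : Lp ℂ 2 (volume : Measure ℝ) →ₗ[ℂ] Lp ℂ 2 P) (hnoise : IsWhiteNoise P D noise) :
    HasOSNR B₁ B₂ A₁ A₂ (lfm m n) noise
        (2 * Real.pi / D * (|chirpH n B₁ + chirpH n B₂| / |1 / A₁ 0 1 + 1 / A₂ 0 1|)) ↔
      chirpL n B₁ B₂ A₁ A₂ = 0 ∧ chirpInv n B₁ ≠ 0 ∧ chirpInv n B₂ ≠ 0 := by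
  have hpi := Real.pi_pos
  have hβ := abs_pos.2 hA
  constructor
  · intro h
    -- the asserted ratio is non-zero as soon as `h₁ + h₂ ≠ 0`, which excludes a peak `0`
    have hv : chirpH n B₁ + chirpH n B₂ ≠ 0 →
        ¬ ∀ t, ∃ W, HasGLWD B₁ B₂ A₁ A₂ (lfm m n) t W ∧ ∀ u, HasImpulse W u 0 := by
      intro hne hW
      have h0 := h.eq_zero_of_forall_hasImpulse_zero hW
      have := abs_pos.2 hne
      have hpos : 0 < 2 * Real.pi / D *
          (|chirpH n B₁ + chirpH n B₂| / |1 / A₁ 0 1 + 1 / A₂ 0 1|) := by positivity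
      exact hpos.ne' h0
    by_cases h₁ : chirpInv n B₁ = 0
    · have hq₁ : innerRate n B₁ = 0 := by
        by_contra hq
        exact (chirpInv_ne_zero_iff hB₁ n).2 hq h₁
      by_cases h₂ : chirpInv n B₂ = 0
      · have hq₂ : innerRate n B₂ = 0 := by
          by_contra hq
          exact (chirpInv_ne_zero_iff hB₂ n).2 hq h₂
        obtain ⟨W, -, -, -, -, hW, -⟩ := h
        exact absurd (hW _) (not_hasGLWD_of_both_eq_zero hB₁ hB₂ hA₁ hA₂ hq₁ hq₂ m _)
      · refine absurd (fun t => exists_hasGLWD_of_left_eq_zero hB₁ hB₂ hq₁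
          ((chirpInv_ne_zero_iff hB₂ n).1 h₂) m t) (hv ?_)
        rw [chirpH, chirpH, h₁, inv_zero, zero_add]
        exact inv_ne_zero h₂
    · have hq₁ := (chirpInv_ne_zero_iff hB₁ n).1 h₁
      by_cases h₂ : chirpInv n B₂ = 0
      · have hq₂ : innerRate n B₂ = 0 := by
          by_contra hq
          exact (chirpInv_ne_zero_iff hB₂ n).2 hq h₂
        refine absurd (fun t => exists_hasGLWD_of_right_eq_zero hB₁ hB₂ hq₁ hq₂ m t) (hv ?_)
        rw [chirpH, chirpH, h₂, inv_zero, add_zero]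
        exact inv_ne_zero h₁
      · have hq₂ := (chirpInv_ne_zero_iff hB₂ n).1 h₂
        refine ⟨?_, h₁, h₂⟩
        by_contra hl
        exact hv (hh h₁ h₂) fun t => ⟨_, hasGLWD_chirpDistribution hB₁ hB₂ hA hq₁ hq₂ m t,
          chirpDistribution_hasImpulse_zero hB₁ hB₂ hA₁ hA₂ hA hq₁ hq₂ hl m t⟩
  · rintro ⟨hl, h₁, h₂⟩
    have hq₁ := (chirpInv_ne_zero_iff hB₁ n).1 h₁
    have hq₂ := (chirpInv_ne_zero_iff hB₂ n).1 h₂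
    have hsum := hh h₁ h₂
    choose C hC hW using
      chirpDistribution_of_chirpL_eq_zero hB₁ hB₂ hA₁ hA₂ hA hq₁ hq₂ hl m
    obtain ⟨E, hE, hEn⟩ := hnoise.exists_hasNoiseMean hB₁ hB₂ hA₁ hA₂ hA hq₁ hq₂ hsum hl
    have k₁ := norm_pos_iff.2 (lctConst_ne_zero hB₁)
    have k₂ := norm_pos_iff.2 (lctConst_ne_zero hB₂)
    have k₃ := norm_pos_iff.2 (lctConst_ne_zero hA₁)
    have k₄ := norm_pos_iff.2 (lctConst_ne_zero hA₂)
    have r₁ : 0 < √(Real.pi / |innerRate n B₁|) :=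
      Real.sqrt_pos.2 (div_pos hpi (abs_pos.2 hq₁))
    have r₂ : 0 < √(Real.pi / |innerRate n B₂|) :=
      Real.sqrt_pos.2 (div_pos hpi (abs_pos.2 hq₂))
    have hs := abs_pos.2 hsum
    -- the frequency of the impulse at time `t`
    set u₀ : ℝ → ℝ := fun t => (signalSlope B₁ B₂ A₁ A₂ n * t + signalOffset B₁ B₂ m n) /
      ((1 / A₁ 0 1 + 1 / A₂ 0 1) / 2) with hu₀
    set peak : ℝ := ‖lctConst B₁‖ * ‖lctConst B₂‖ *
      (√(Real.pi / |innerRate n B₁|) * √(Real.pi / |innerRate n B₂|)) *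
      (‖lctConst A₁‖ * ‖lctConst A₂‖) * (4 * Real.pi / |1 / A₁ 0 1 + 1 / A₂ 0 1|) with hpeak
    have hpeak0 : 0 < peak := by positivity
    set M : ℝ := |D| * (‖lctConst B₁‖ * ‖lctConst B₂‖ * (‖lctConst A₁‖ * ‖lctConst A₂‖)) *
        (√(Real.pi / |innerRate n B₁|) * √(Real.pi / |innerRate n B₂|) *
          (2 / |chirpH n B₁ + chirpH n B₂|)) with hM
    have hM0 : 0 < M := by
      have := abs_pos.2 hD.ne'
      positivity
    have hc : ∀ t u, ‖(if u = u₀ t then C t else 0 : ℂ)‖ = if u = u₀ t then peak else 0 := by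
      intro t u
      split_ifs
      · exact hC t
      · exact norm_zero
    have hset : {z : EuclideanSpace ℝ (Fin 2) |
        ‖(if z 1 = u₀ (z 0) then C (z 0) else 0 : ℂ)‖ = peak}
        = {z | z 1 = signalSlope B₁ B₂ A₁ A₂ n / ((1 / A₁ 0 1 + 1 / A₂ 0 1) / 2) * z 0
          + signalOffset B₁ B₂ m n / ((1 / A₁ 0 1 + 1 / A₂ 0 1) / 2)} := by
      ext z
      have he : u₀ (z 0) = signalSlope B₁ B₂ A₁ A₂ n / ((1 / A₁ 0 1 + 1 / A₂ 0 1) / 2) * z 0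
          + signalOffset B₁ B₂ m n / ((1 / A₁ 0 1 + 1 / A₂ 0 1) / 2) := by
        rw [hu₀]
        ring
      rw [Set.mem_ofPred_eq, Set.mem_ofPred_eq, hc, ← he]
      split_ifs with hz
      · simp [hz]
      · simp [hz, hpeak0.ne]
    refine ⟨chirpDistribution B₁ B₂ A₁ A₂ m n, fun t u => if u = u₀ t then C t else 0, E, peak, M,
      hasGLWD_chirpDistribution hB₁ hB₂ hA hq₁ hq₂ m, fun t u => hasImpulse_of_eval (hW t) u,
      ⟨⟨(0, u₀ 0), (hc 0 (u₀ 0)).trans (if_pos rfl)⟩, ?_⟩, hE, ?_, hM0.ne', ?_⟩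
    · rintro _ ⟨z, rfl⟩
      simp only [hc]
      split_ifs
      · exact le_rfl
      · exact hpeak0.le
    · simp only [hEn]
      rw [hset]
      exact hasMeanOver_line _ _ _
    · rw [hpeak, hM, abs_of_pos hD]
      field_simp
      ring
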